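/- Let $k$ be a field of characteristic $p\ge 0$, let $n\ge 0$, let $G$ be a subgroup of the symmetric group $S_n$, and let $G$ act on $\mathbb{A}^n_k=\operatorname{Spec} k[x_1,\dots,x_n]$ by permuting the coordinates. Let $X=\mathbb{A}^n_k/G=\operatorname{Spec} k[x_1,\dots,x_n]^G$ be the quotient variety, and let $K_X$ be a canonical divisor of $X$, that is, the Weil divisor of a nonzero rational $n$-form on the normal $n$-dimensional variety $X$. Then $X$ is $2$-Gorenstein, that is, $2K_X$ is Cartier. Moreover, if $p=2$, then $X$ is $1$-Gorenstein, that is, $K_X$ is Cartier. -/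

import Mathlib

open scoped KaehlerDifferential

noncomputable section

namespace PermQuotient

/-- The ring of invariants `k[x_1, …, x_n]^G` of a permutation group `G ≤ S_n` acting on the
coordinates. The quotient variety `𝔸ⁿ / G` is the affine variety `Spec k[x_1, …, x_n]^G`. -/
def invariantRing (k : Type*) [Field k] {n : ℕ} (G : Subgroup (Equiv.Perm (Fin n))) :
    Subalgebra k (MvPolynomial (Fin n) k) where
  carrier := {f | ∀ σ ∈ G, MvPolynomial.rename σ f = f}
  mul_mem' hf hg σ hσ := by rw [map_mul, hf σ hσ, hg σ hσ]
  add_mem' hf hg σ hσ := by rw [map_add, hf σ hσ, hg σ hσ]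
  algebraMap_mem' r σ _ := by rw [AlgHom.commutes]

/-! ### Divisors on an affine normal variety `X = Spec A`

Points of `X` are elements of `PrimeSpectrum A`, its function field is `FractionRing A`, and
its basic open subsets are the sets `{x | s ∉ x}` for `s : A`. -/

section Divisors

variable (A : Type*) [CommRing A] [IsDomain A]

/-- The prime divisors of `Spec A`, given by their generic points: the primes of height one. -/
def PrimeDivisor : Type _ := {P : PrimeSpectrum A // P.asIdeal.height = 1}

/-- Weil divisors on `Spec A`: finite integral combinations of prime divisors. -/
abbrev WeilDivisor : Type _ := PrimeDivisor A →₀ ℤ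

variable {A}

/-- The local ring `𝒪_{X,x} = A_x`, realised inside the function field as the set of all
fractions `a / s` with `s ∉ x`. -/
def localRing (x : PrimeSpectrum A) : Subalgebra A (FractionRing A) :=
  Localization.subalgebra.ofField (FractionRing A) x.asIdeal.primeCompl
    x.asIdeal.primeCompl_le_nonZeroDivisors

/-- `ϖ` is a uniformizer of `𝒪_{X,P}`: it is a nonzero generator of the maximal ideal. -/
def IsUniformizer (P : PrimeDivisor A) (ϖ : localRing P.1) : Prop :=
  ϖ ≠ 0 ∧ Ideal.span {ϖ} = P.1.asIdeal.map (algebraMap A (localRing P.1))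

/-- Let `W` be a vector space over the function field and `L ⊆ W` a free `𝒪_{X,P}`-submodule of
rank one. An element `w` of the line spanned by `L` has order `m` along `P` with respect to `L`
if `w = ϖ ^ m • e` for a uniformizer `ϖ` and a generator `e` of `L`; that is, if
`𝒪_{X,P} w = 𝔪_P ^ m L`. (The integer `m` is unique if `w ≠ 0`.) -/
def HasOrder (P : PrimeDivisor A) {W : Type*} [AddCommGroup W] [Module (FractionRing A) W]
    (L : Submodule (localRing P.1) W) (w : W) (m : ℤ) : Prop :=
  ∃ ϖ : localRing P.1, IsUniformizer P ϖ ∧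
    ∃ e : W, L = Submodule.span (localRing P.1) {e} ∧ w = (ϖ : FractionRing A) ^ m • e

/-- The rational function `f` has order `m` along the prime divisor `P`: here
`W` is the function field and `L = 𝒪_{X,P}`. -/
def FunctionHasOrder (P : PrimeDivisor A) (f : FractionRing A) (m : ℤ) : Prop :=
  HasOrder P (Submodule.span (localRing P.1) {(1 : FractionRing A)}) f m

/-- A Weil divisor is Cartier if it is locally principal: every point has an open neighbourhood
(which may be taken basic open) on which the divisor is the divisor of a nonzero rational
function. -/
def WeilDivisor.IsCartier (D : WeilDivisor A) : Prop :=
  ∀ x : PrimeSpectrum A, ∃ s : A, s ∉ x.asIdeal ∧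
    ∃ f : FractionRing A, f ≠ 0 ∧
      ∀ P : PrimeDivisor A, s ∉ P.1.asIdeal → FunctionHasOrder P f (D P)

end Divisors

/-! ### Canonical divisors -/

section Canonical

variable (k : Type*) [Field k] {A : Type*} [CommRing A] [IsDomain A] [Algebra k A]

/-- The `𝒪_{X,P}`-module of rational `n`-forms regular at the generic point of `P`, for `X` of
dimension `n` and smooth over `k` at that point: the image of `⋀ⁿ Ω_{𝒪_{X,P}/k}` in
`⋀ⁿ Ω_{k(X)/k}`, which is spanned by the forms `da_1 ∧ ⋯ ∧ da_n` with `a_i ∈ 𝒪_{X,P}`. -/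
def regularForms (n : ℕ) (P : PrimeDivisor A) :
    Submodule (localRing P.1) (⋀[FractionRing A]^n (Ω[FractionRing A⁄k])) :=
  Submodule.span (localRing P.1) (Set.range fun a : Fin n → localRing P.1 =>
    exteriorPower.ιMulti (FractionRing A) n
      fun i => KaehlerDifferential.D k (FractionRing A) (a i : FractionRing A))

/-- `K` is a canonical divisor of the `n`-dimensional normal variety `Spec A` over `k` (smooth
over `k` in codimension one, as `𝔸ⁿ / G` always is): it is the divisor of a nonzero
rational `n`-form. -/
def IsCanonicalDivisor (n : ℕ) (K : WeilDivisor A) : Prop :=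
  ∃ ω : ⋀[FractionRing A]^n (Ω[FractionRing A⁄k]), ω ≠ 0 ∧
    ∀ P : PrimeDivisor A, HasOrder P (regularForms k n P) ω (K P)

variable (A) in
/-- The `n`-dimensional normal variety `X = Spec A` over `k` is `r`-Gorenstein: `r K_X` is
Cartier. Canonical divisors are only defined up to linear equivalence, so this asks that one
exists and that the condition holds for every choice. -/
def IsGorensteinOfIndex (n r : ℕ) : Prop :=
  (∃ K : WeilDivisor A, IsCanonicalDivisor k n K) ∧
    ∀ K : WeilDivisor A, IsCanonicalDivisor k n K → WeilDivisor.IsCartier (r • K)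

end Canonical

end PermQuotient

end

open scoped KaehlerDifferential

noncomputable section

namespace PermQuotient

/-! Write `B = k[x_1, …, x_n]`, `A = B^G`, and let `Δ` be the product of the `x_i - x_j`, `i < j`,
over the transpositions `(i j)` in `G`. Pulled back to affine space, `da_1 ∧ ⋯ ∧ da_n` becomes `J
dx_1 ∧ ⋯ ∧ dx_n`, with `J` the Jacobian determinant of `a`. In codimension one these determinants
generate the same ideal as `Δ` (`exists_reflForm_eq_mul`), so along a prime divisor `P` the regular
forms have a generator with coordinate `Δ` times a unit (`exists_regularForms_eq_span`). Hence if
`K` is the divisor of `f da_1 ∧ ⋯ ∧ da_n`, then `f J / Δ` is `ϖ ^ K(P)` times a unit, for `ϖ` a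
uniformizer at `P`. An element of `G` changes `J` and `Δ` only by signs, so `(f J / Δ) ^ r` lies in
the function field of `X` for `r = 2`, and for `r = 1` in characteristic two. It is a global
equation of `r K`, which is thus even principal.

For the claim in codimension one, fix a prime `q` of `B`. A nontrivial element of `G` acting
trivially modulo `q` must be a transposition `(i j)` with `q` associated to `x_i - x_j`, so the
inertia group `I` has order at most two. Up to a factor prime to `q`, gradients of `I`-invariants
are combinations of gradients of `G`-invariants (`exists_smul_grad_mem`). It remains to look at
`B^I`, where `x_i + x_j`, `x_i x_j` and the other `x_l` have Jacobian determinant `x_i - x_j` up to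
sign in every characteristic, so wild ramification does no harm. -/

open MvPolynomial

/-! ### Separating ring homomorphisms that have equal sums -/

section Separation

variable {R Z ι : Type*} [CommRing R] [CommRing Z] [Fintype ι]

/-- Expanding one squared factor absorbs `1`, `w a` or `w a ^ 2` into the argument `z`, with
coefficients independent of `i`. The identity thus reduces to `hfg` at various arguments, and the
induction must let `z` vary. -/
theorem sum_mul_prod_sub_sq_eq {κ : Type*} (f g : ι → Z →+* R)
    (hfg : ∀ z, ∑ i, f i z = ∑ i, g i z) (b : κ → R) (w : κ → Z) (S : Finset κ) (z : Z) :
    ∑ i, f i z * ∏ j ∈ S, (b j - f i (w j)) ^ 2 = ∑ i, g i z * ∏ j ∈ S, (b j - g i (w j)) ^ 2 := by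
  classical
  induction S using Finset.induction_on generalizing z with
  | empty => simpa using hfg z
  | insert a S ha ih =>
    have key : ∀ e : ι → Z →+* R,
        ∑ i, e i z * ∏ j ∈ insert a S, (b j - e i (w j)) ^ 2 =
          b a ^ 2 * ∑ i, e i z * ∏ j ∈ S, (b j - e i (w j)) ^ 2
          - 2 * b a * ∑ i, e i (z * w a) * ∏ j ∈ S, (b j - e i (w j)) ^ 2
          + ∑ i, e i (z * w a ^ 2) * ∏ j ∈ S, (b j - e i (w j)) ^ 2 := by
      intro e
      rw [Finset.mul_sum, Finset.mul_sum, ← Finset.sum_sub_distrib, ← Finset.sum_add_distrib]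
      refine Finset.sum_congr rfl fun i _ => ?_
      rw [Finset.prod_insert ha, map_mul, map_mul, map_pow]
      ring
    rw [key, key, ih, ih, ih]

/-- Two families of ring homomorphisms with the same sum, which agree up to square-zero elements,
agree at an index as far as that index can be separated from the others. -/
theorem prod_sub_sq_mul_sub_eq_zero [DecidableEq ι] (f g : ι → Z →+* R)
    (hfg : ∀ z, ∑ i, f i z = ∑ i, g i z) (o : ι) (w : ι → Z)
    (hw : ∀ i, (g i (w i) - f i (w i)) ^ 2 = 0) (z : Z) :
    (∏ i ∈ Finset.univ.erase o, (g i (w i) - g o (w i)) ^ 2) * (f o z - g o z) = 0 := by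
  have h (z : Z) : f o z * ∏ j ∈ Finset.univ.erase o, (g j (w j) - f o (w j)) ^ 2 =
      g o z * ∏ j ∈ Finset.univ.erase o, (g j (w j) - g o (w j)) ^ 2 := by
    -- With `b i = g i (w i)` every term `i ≠ o` vanishes: on the `g` side trivially, on the `f`
    -- side by `hw`. This is why the factors are squared.
    have := sum_mul_prod_sub_sq_eq f g hfg (fun i => g i (w i)) w (Finset.univ.erase o) z
    rwa [Finset.sum_eq_single o, Finset.sum_eq_single o] at this
    · intro i _ hi
      rw [Finset.prod_eq_zero (i := i) (by simp [hi]) (by simp), mul_zero]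
    · simp
    · intro i _ hi
      rw [Finset.prod_eq_zero (i := i) (by simp [hi]) (hw i), mul_zero]
    · simp
  -- The case `z = 1` says that the multipliers on the two sides coincide.
  have h1 := h 1
  rw [map_one, map_one, one_mul, one_mul] at h1
  have hz := h z
  rw [h1] at hz
  linear_combination hz

end Separation

/-! ### Derivations that kill a sum of homomorphisms -/

section SquareZero

variable {k B M Z ι : Type*} [CommRing k] [CommRing B] [Algebra k B] [AddCommGroup M] [Module k M]
  [Module B M] [CommRing Z] [Fintype ι] [DecidableEq ι]

/-- The ring homomorphism `b ↦ b + D b` into the trivial square-zero extension. -/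
def derivationHom [Module Bᵐᵒᵖ M] [IsCentralScalar B M] (D : Derivation k B M) :
    B →+* TrivSqZeroExt B M where
  toFun b := TrivSqZeroExt.inl b + TrivSqZeroExt.inr (D b)
  map_one' := by simp
  map_mul' x y := by ext <;> simp
  map_zero' := by simp
  map_add' x y := by ext <;> simp

/-- In the square-zero extension of `B` by `M`, the families `r i` and `r i + D ∘ r i` have the same
sum by `hD` and differ by square-zero elements, so the separation lemma applies to them. -/
theorem prod_sub_sq_smul_derivation_eq_zero (D : Derivation k B M) (r : ι → Z →+* B)
    (hD : ∀ z, D (∑ i, r i z) = 0) (o : ι) (w : ι → Z) (z : Z) :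
    (∏ i ∈ Finset.univ.erase o, (r i (w i) - r o (w i)) ^ 2) • D (r o z) = 0 := by
  let _ : Module Bᵐᵒᵖ M := Module.compHom M ((RingHom.id B).fromOpposite mul_comm)
  have : IsCentralScalar B M := ⟨fun _ _ => rfl⟩
  have hd (b : B) : derivationHom D b = TrivSqZeroExt.inlHom B M b + TrivSqZeroExt.inr (D b) := rfl
  have key := prod_sub_sq_mul_sub_eq_zero
    (fun i => (derivationHom D).comp (r i)) (fun i => (TrivSqZeroExt.inlHom B M).comp (r i))
    (fun z => by
      simp only [RingHom.comp_apply]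
      rw [← map_sum, ← map_sum, hd, hD, TrivSqZeroExt.inr_zero, add_zero])
    o w
    (fun i => by
      rw [RingHom.comp_apply, RingHom.comp_apply, hd, sub_add_cancel_left, neg_sq, sq,
        TrivSqZeroExt.inr_mul_inr]) z
  simp only [RingHom.comp_apply, ← map_sub, ← map_pow, ← map_prod] at key
  rw [hd, add_sub_cancel_left] at key
  have h0 := congrArg TrivSqZeroExt.snd ((TrivSqZeroExt.inl_mul_inr _ _).symm.trans key)
  exact h0

end SquareZero

/-! ### Gradients of invariants and transfer from an inertia group -/

variable {k : Type*} [Field k] {n : ℕ}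

/-- The gradient of a polynomial. -/
def grad (k : Type*) [Field k] (n : ℕ) :
    Derivation k (MvPolynomial (Fin n) k) (Fin n → MvPolynomial (Fin n) k) :=
  mkDerivation k fun i => Pi.single i 1

theorem grad_apply (f : MvPolynomial (Fin n) k) (i : Fin n) : grad k n f i = pderiv i f := by
  have : (LinearMap.proj (R := MvPolynomial (Fin n) k) i).compDer (grad k n) = pderiv i := by
    ext j
    simp [grad, pderiv_X, Pi.single_apply, eq_comm]
  exact Derivation.congr_fun this f

/-- The span of the gradients of the invariants. -/
def gradSpan (k : Type*) [Field k] {n : ℕ} (G : Subgroup (Equiv.Perm (Fin n))) :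
    Submodule (MvPolynomial (Fin n) k) (Fin n → MvPolynomial (Fin n) k) :=
  Submodule.span _ (grad k n '' (invariantRing k G))

section Transfer

variable {G I : Subgroup (Equiv.Perm (Fin n))}

theorem rename_mul (g h : Equiv.Perm (Fin n)) (f : MvPolynomial (Fin n) k) :
    rename (g * h : Equiv.Perm (Fin n)) f = rename g (rename h f) := by
  rw [rename_rename]; rfl

theorem rename_eq_of_inv_mul_mem {g h : Equiv.Perm (Fin n)} (hgh : g⁻¹ * h ∈ I)
    {z : MvPolynomial (Fin n) k} (hz : z ∈ invariantRing k I) : rename g z = rename h z := by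
  conv_lhs => rw [← hz _ hgh]
  rw [← rename_mul, mul_inv_cancel_left]

/-- The relative trace of an `I`-invariant polynomial is `G`-invariant. -/
theorem sum_rename_mem [Fintype (G ⧸ I.subgroupOf G)] {z : MvPolynomial (Fin n) k}
    (hz : z ∈ invariantRing k I) :
    ∑ h : G ⧸ I.subgroupOf G, rename (h.out : Equiv.Perm (Fin n)) z ∈ invariantRing k G := by
  intro σ hσ
  rw [map_sum]
  refine Fintype.sum_equiv (MulAction.toPerm (⟨σ, hσ⟩ : G)) _ _ fun h => ?_
  rw [← rename_mul]
  refine rename_eq_of_inv_mul_mem ?_ hz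
  have : ((⟨σ, hσ⟩ : G) * h.out)⁻¹ * ((⟨σ, hσ⟩ : G) • h).out ∈ I.subgroupOf G := by
    rw [← QuotientGroup.eq, QuotientGroup.out_eq']
    conv_rhs => rw [← QuotientGroup.out_eq' h]
    rfl
  simpa [Subgroup.mem_subgroupOf] using this

/-- The extension `k[x]^G ⊆ k[x]^I` is unramified at a prime at which `I` is the inertia group. -/
theorem exists_smul_grad_mem (Q : Ideal (MvPolynomial (Fin n) k)) [Q.IsPrime]
    (hI : ∀ g ∈ G, g ∉ I → ∃ w ∈ invariantRing k I, rename g w - w ∉ Q) :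
    ∃ u ∉ Q, ∀ z ∈ invariantRing k I, u • grad k n z ∈ gradSpan k G := by
  classical
  let B := MvPolynomial (Fin n) k
  let M := (Fin n → B) ⧸ gradSpan k G
  let H := G ⧸ I.subgroupOf G
  -- Modulo gradients of `G`-invariants, the gradient kills relative traces from `I` to `G`. The
  -- homomorphisms to separate are the conjugates of the inclusion of the `I`-invariants, indexed by
  -- cosets.
  let D : Derivation k B M := (gradSpan k G).mkQ.compDer (grad k n)
  have hD (b : B) : D b = (gradSpan k G).mkQ (grad k n b) := rfl
  have hH : ∀ h : H, ∃ w : invariantRing k I, h ≠ ((1 : G) : H) →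
      rename (h.out : Equiv.Perm (Fin n)) (w : B) - w ∉ Q := by
    intro h
    by_cases hh : h = ((1 : G) : H)
    -- The trivial coset gets a dummy value: the product defining the multiplier omits it.
    · exact ⟨0, fun h' => (h' hh).elim⟩
    · obtain ⟨w, hw, hwQ⟩ := hI h.out h.out.2 fun hmem => hh <| by
        rw [← QuotientGroup.out_eq' h, QuotientGroup.eq, mul_one]
        exact inv_mem (Subgroup.mem_subgroupOf.2 hmem)
      exact ⟨⟨w, hw⟩, fun _ => hwQ⟩
  choose w hw using hH
  let r (h : H) : invariantRing k I →+* B :=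
    (rename (R := k) (h.out : Equiv.Perm (Fin n))).toRingHom.comp (invariantRing k I).val.toRingHom
  have hr (h : H) (z : invariantRing k I) : r h z = rename (h.out : Equiv.Perm (Fin n)) (z : B) := rfl
  have hr1 (z : invariantRing k I) : r ((1 : G) : H) z = z := by
    rw [hr]
    apply z.2
    have : ((1 : G))⁻¹ * (((1 : G) : H)).out ∈ I.subgroupOf G := by
      rw [← QuotientGroup.eq, QuotientGroup.out_eq']
    simpa [Subgroup.mem_subgroupOf] using this
  have key := prod_sub_sq_smul_derivation_eq_zero D r (fun z => by
    rw [hD, Submodule.mkQ_apply, Submodule.Quotient.mk_eq_zero]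
    exact Submodule.subset_span ⟨_, sum_rename_mem z.2, rfl⟩) ((1 : G) : H) w
  refine ⟨∏ h ∈ Finset.univ.erase ((1 : G) : H), (r h (w h) - r ((1 : G) : H) (w h)) ^ 2, ?_, ?_⟩
  · rw [Ideal.IsPrime.prod_mem_iff]
    rintro ⟨h, hh, hmem⟩
    rw [hr1, hr] at hmem
    exact hw h (Finset.mem_erase.1 hh).1 (Ideal.IsPrime.mem_of_pow_mem ‹_› _ hmem)
  · intro z hz
    have := key ⟨z, hz⟩
    rwa [hr1 ⟨z, hz⟩, hD, ← map_smul, Submodule.mkQ_apply, Submodule.Quotient.mk_eq_zero] at this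

end Transfer

open MvPolynomial

/-! ### Multilinear maps and determinants -/

section LinearAlgebra

/-- Expand one slot at a time: the induction is on the set `T` of slots not yet known to lie in `S`
itself. -/
theorem multilinearMap_apply_mem_span {R M N ι : Type*} [CommSemiring R] [AddCommMonoid M]
    [AddCommMonoid N] [Module R M] [Module R N] [Finite ι]
    (f : MultilinearMap R (fun _ : ι => M) N) {S : Set M} {v : ι → M}
    (hv : ∀ i, v i ∈ Submodule.span R S) :
    f v ∈ Submodule.span R (f '' {w | ∀ i, w i ∈ S}) := by
  classical
  cases nonempty_fintype ι
  suffices h : ∀ T : Finset ι, ∀ v : ι → M, (∀ i ∈ T, v i ∈ Submodule.span R S) →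
      (∀ i ∉ T, v i ∈ S) → f v ∈ Submodule.span R (f '' {w | ∀ i, w i ∈ S}) from
    h Finset.univ v (fun i _ => hv i) (by simp)
  intro T
  induction T using Finset.induction_on with
  | empty => exact fun v _ hv => Submodule.subset_span ⟨v, fun i => hv i (by simp), rfl⟩
  | insert a T ha ih =>
    intro v hT hS
    have key : ∀ x ∈ Submodule.span R S,
        f (Function.update v a x) ∈ Submodule.span R (f '' {w | ∀ i, w i ∈ S}) := by
      intro x hx
      induction hx using Submodule.span_induction with
      | mem x hx =>
        refine ih _ (fun i hi => ?_) fun i hi => ?_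
        · rw [Function.update_of_ne (by rintro rfl; exact ha hi)]
          exact hT i (Finset.mem_insert_of_mem hi)
        · by_cases hia : i = a
          · subst hia; simpa
          · rw [Function.update_of_ne hia]
            exact hS i (by simp [hia, hi])
      | zero => rw [f.map_update_zero]; exact zero_mem _
      | add x y _ _ hx hy => rw [f.map_update_add]; exact add_mem hx hy
      | smul c x _ hx => rw [f.map_update_smul]; exact Submodule.smul_mem _ _ hx
    simpa using key (v a) (hT a (Finset.mem_insert_self _ _))

theorem dvd_det_of_dvd_sub {R ι : Type*} [CommRing R] [Fintype ι] [DecidableEq ι]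
    {M : Matrix ι ι R} {d : R} {i j : ι} (hij : i ≠ j) (h : ∀ r, d ∣ M r i - M r j) :
    d ∣ M.det := by
  rw [← Ideal.mem_span_singleton, ← Ideal.Quotient.eq_zero_iff_mem, RingHom.map_det]
  refine Matrix.det_zero_of_column_eq hij fun r => ?_
  rw [RingHom.mapMatrix_apply, Matrix.map_apply, Matrix.map_apply, Ideal.Quotient.eq,
    Ideal.mem_span_singleton]
  exact h r

end LinearAlgebra

variable {k : Type*} [Field k] {n : ℕ}

/-! ### The linear forms `x_i - x_j` -/

section LinearForms

theorem X_sub_X_ne_zero {i j : Fin n} (hij : i ≠ j) :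
    (X i - X j : MvPolynomial (Fin n) k) ≠ 0 :=
  sub_ne_zero.2 fun h => hij (X_injective h)

theorem irreducible_X_sub_X {i j : Fin n} (hij : i ≠ j) :
    Irreducible (X i - X j : MvPolynomial (Fin n) k) := by
  refine irreducible_of_totalDegree_eq_one ?_ fun x hx => ?_
  · exact ((isHomogeneous_X k i).sub (isHomogeneous_X k j)).totalDegree (X_sub_X_ne_zero hij)
  · have := hx (Finsupp.single i 1)
    rw [coeff_sub, coeff_X, coeff_X, if_pos rfl,
      if_neg fun h => hij (Finsupp.single_left_injective one_ne_zero h).symm, sub_zero] at this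
    exact isUnit_of_dvd_one this

/-- Substituting `x_i` for `x_j` kills the divisor, hence also `x_l - x_m`; this identifies two
distinct variables only if they are `x_i` and `x_j`. -/
theorem eq_or_eq_of_X_sub_X_dvd {i j l m : Fin n} (hlm : l ≠ m)
    (h : (X i - X j : MvPolynomial (Fin n) k) ∣ X l - X m) :
    l = i ∧ m = j ∨ l = j ∧ m = i := by
  let e : MvPolynomial (Fin n) k →ₐ[k] MvPolynomial (Fin n) k :=
    aeval fun t => if t = j then X i else X t
  have he : e (X i - X j) = 0 := by by_cases hij : i = j <;> simp [e, hij]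
  have h0 : e (X l - X m) = 0 := by
    obtain ⟨c, hc⟩ := h
    rw [hc, map_mul, he, zero_mul]
  rw [map_sub, sub_eq_zero] at h0
  simp only [e, aeval_X] at h0
  split_ifs at h0 with h1 h2 h2
  · exact (hlm (h1.trans h2.symm)).elim
  · exact .inr ⟨h1, (X_injective h0).symm⟩
  · exact .inl ⟨X_injective h0, h2⟩
  · exact (hlm (X_injective h0)).elim

theorem X_sub_X_dvd_rename_swap_sub (i j : Fin n) (f : MvPolynomial (Fin n) k) :
    (X i - X j : MvPolynomial (Fin n) k) ∣ rename (Equiv.swap i j) f - f := by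
  have : ((Ideal.Quotient.mkₐ k (Ideal.span {(X i - X j : MvPolynomial (Fin n) k)})).comp
      (rename (Equiv.swap i j))) = Ideal.Quotient.mkₐ k _ := by
    ext t
    simp only [AlgHom.comp_apply, rename_X, Ideal.Quotient.mkₐ_eq_mk]
    rw [Ideal.Quotient.eq, Ideal.mem_span_singleton, Equiv.swap_apply_def]
    split_ifs with h1 h2
    · rw [h1, dvd_sub_comm]
    · rw [h2]
    · simp
  rw [← Ideal.mem_span_singleton, ← Ideal.Quotient.eq]
  exact DFunLike.congr_fun this f

end LinearForms

/-! ### Jacobian determinants of invariants in codimension one -/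

section Jacobian

variable {G : Subgroup (Equiv.Perm (Fin n))}

/-- The Jacobian determinant of `n` polynomials in `n` variables. -/
def jac (a : Fin n → MvPolynomial (Fin n) k) : MvPolynomial (Fin n) k :=
  Matrix.det (Matrix.of fun i => grad k n (a i))

theorem rename_pderiv (σ : Equiv.Perm (Fin n)) (i : Fin n) (f : MvPolynomial (Fin n) k) :
    rename σ (pderiv i f) = pderiv (σ i) (rename σ f) :=
  (pderiv_rename σ.injective i f).symm

/-- Since `σ` fixes each `a i` and permutes the partial derivatives, it just permutes the columns of
the Jacobian matrix. -/
theorem rename_jac (σ : Equiv.Perm (Fin n)) {a : Fin n → MvPolynomial (Fin n) k}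
    (ha : ∀ i, rename σ (a i) = a i) : rename σ (jac a) = Equiv.Perm.sign σ * jac a := by
  rw [jac, AlgHom.map_det, ← Matrix.det_permute']
  congr 1
  ext1 i j
  simp only [AlgHom.mapMatrix_apply, Matrix.map_apply, Matrix.of_apply, Matrix.submatrix_apply,
    grad_apply, rename_pderiv, ha, id]

/-- For an invariant `f`, the swap carries `∂_j f` to `∂_i f`, and it acts trivially modulo `x_i -
x_j`; so columns `i` and `j` agree modulo this form. -/
theorem X_sub_X_dvd_jac {i j : Fin n} (hij : i ≠ j) (hG : Equiv.swap i j ∈ G)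
    {a : Fin n → MvPolynomial (Fin n) k} (ha : ∀ l, a l ∈ invariantRing k G) :
    (X i - X j : MvPolynomial (Fin n) k) ∣ jac a := by
  refine dvd_det_of_dvd_sub hij fun r => ?_
  have := X_sub_X_dvd_rename_swap_sub i j (pderiv j (a r))
  rwa [rename_pderiv, Equiv.swap_apply_right, ha r _ hG, ← grad_apply, ← grad_apply] at this

/-- By multilinearity `u ^ n * d` is a combination of Jacobians `jac a = d * c`. If every such `c`
were in `Q`, cancelling `d` would put `u ^ n` in `Q`. -/
theorem exists_jac_eq_mul_of_smul_mem {Q : Ideal (MvPolynomial (Fin n) k)} [Q.IsPrime]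
    {u : MvPolynomial (Fin n) k} (hu : u ∉ Q) {v : Fin n → Fin n → MvPolynomial (Fin n) k}
    (hv : ∀ i, u • v i ∈ gradSpan k G) {d : MvPolynomial (Fin n) k} (hd0 : d ≠ 0)
    (hd : Matrix.det (Matrix.of v) = d)
    (hdvd : ∀ a : Fin n → MvPolynomial (Fin n) k, (∀ l, a l ∈ invariantRing k G) → d ∣ jac a) :
    ∃ a : Fin n → MvPolynomial (Fin n) k, (∀ l, a l ∈ invariantRing k G) ∧
      ∃ c ∉ Q, jac a = d * c := by
  by_contra! hcon
  have h1 := multilinearMap_apply_mem_span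
    (Matrix.detRowAlternating (n := Fin n) (R := MvPolynomial (Fin n) k)).toMultilinearMap
    (v := fun i => u • v i) hv
  have h2 : Submodule.span (MvPolynomial (Fin n) k)
      ((Matrix.detRowAlternating (n := Fin n) (R := MvPolynomial (Fin n) k)).toMultilinearMap ''
        {w | ∀ i, w i ∈ grad k n '' (invariantRing k G)}) ≤ Ideal.span {d} * Q := by
    rw [Submodule.span_le]
    rintro _ ⟨w, hw, rfl⟩
    choose a ha haw using hw
    obtain rfl : (fun i => grad k n (a i)) = w := funext haw
    change jac a ∈ _
    obtain ⟨c, hc⟩ := hdvd a ha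
    rw [hc]
    refine Ideal.mul_mem_mul (Ideal.mem_span_singleton_self d) ?_
    by_contra hcQ
    exact hcon a ha c hcQ hc
  have h3 := h2 h1
  rw [MultilinearMap.map_smul_univ] at h3
  change (∏ _, u) * Matrix.det (Matrix.of v) ∈ _ at h3
  rw [hd, Ideal.mem_span_singleton_mul] at h3
  obtain ⟨z, hz, hzd⟩ := h3
  rw [mul_comm] at hzd
  rw [mul_right_cancel₀ hd0 hzd] at hz
  rw [Finset.prod_const] at hz
  exact hu (Ideal.IsPrime.mem_of_pow_mem ‹_› _ hz)

theorem grad_X (i : Fin n) : grad k n (X i) = Pi.single i 1 := mkDerivation_X _ _ _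

theorem mem_invariantRing_bot (f : MvPolynomial (Fin n) k) : f ∈ invariantRing k ⊥ := by
  intro σ hσ
  rw [Subgroup.mem_bot.1 hσ]
  exact rename_id_apply f

theorem exists_jac_notMem_of_trivial_inertia (Q : Ideal (MvPolynomial (Fin n) k)) [Q.IsPrime]
    (hQ : ∀ g ∈ G, g ≠ 1 → ∃ l, (X (g l) - X l : MvPolynomial (Fin n) k) ∉ Q) :
    ∃ a : Fin n → MvPolynomial (Fin n) k, (∀ l, a l ∈ invariantRing k G) ∧ jac a ∉ Q := by
  obtain ⟨u, hu, h⟩ := exists_smul_grad_mem (G := G) (I := ⊥) Q fun g hg hg1 => by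
    obtain ⟨l, hl⟩ := hQ g hg fun h => hg1 (Subgroup.mem_bot.2 h)
    exact ⟨X l, mem_invariantRing_bot _, by rwa [rename_X]⟩
  obtain ⟨a, ha, c, hc, hac⟩ := exists_jac_eq_mul_of_smul_mem hu
    (v := fun i => grad k n (X i)) (fun i => h _ (mem_invariantRing_bot _)) one_ne_zero
    (by
      rw [← Matrix.det_one (n := Fin n)]
      congr 1
      ext1 i j
      simp [grad_X, Matrix.one_apply, Pi.single_apply, eq_comm]) fun a _ => one_dvd _
  exact ⟨a, ha, by rwa [hac, one_mul]⟩

variable (k G) in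
/-- There are `n` invariants with nonzero Jacobian determinant. -/
theorem exists_jac_ne_zero :
    ∃ a : Fin n → MvPolynomial (Fin n) k, (∀ l, a l ∈ invariantRing k G) ∧ jac a ≠ 0 := by
  obtain ⟨a, ha, h⟩ := exists_jac_notMem_of_trivial_inertia (G := G)
    -- At the generic point inertia is trivial, because `G` acts faithfully on the variables.
    (⊥ : Ideal (MvPolynomial (Fin n) k)) fun g _ hg => by
      obtain ⟨l, hl⟩ := DFunLike.ne_iff.1 hg
      exact ⟨l, fun h => X_sub_X_ne_zero hl (Ideal.mem_bot.1 h)⟩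
  exact ⟨a, ha, h⟩

theorem mem_invariantRing_zpowers {τ : Equiv.Perm (Fin n)} {f : MvPolynomial (Fin n) k}
    (h : rename τ f = f) : f ∈ invariantRing k (Subgroup.zpowers τ) := by
  intro σ hσ
  rw [Subgroup.zpowers_eq_closure] at hσ
  induction hσ using Subgroup.closure_induction with
  | mem x hx => rwa [Set.mem_singleton_iff.1 hx]
  | one => exact rename_id_apply f
  | mul x y _ _ hx hy => rw [rename_mul, hy, hx]
  | inv x _ hx =>
    conv_lhs => rw [← hx]
    rw [← rename_mul, inv_mul_cancel]
    exact rename_id_apply f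

theorem exists_jac_eq_X_sub_X_mul {i j : Fin n} (hij : i ≠ j) (hG : Equiv.swap i j ∈ G)
    {Q : Ideal (MvPolynomial (Fin n) k)} [Q.IsPrime]
    (hQ : ∀ l m, l ≠ m → (X l - X m : MvPolynomial (Fin n) k) ∈ Q →
      l = i ∧ m = j ∨ l = j ∧ m = i) :
    ∃ a : Fin n → MvPolynomial (Fin n) k, (∀ l, a l ∈ invariantRing k G) ∧
      ∃ c ∉ Q, jac a = (X i - X j) * c := by
  have hX (l) (hi : l ≠ i) (hj : l ≠ j) :
      (X l : MvPolynomial (Fin n) k) ∈ invariantRing k (Subgroup.zpowers (Equiv.swap i j)) :=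
    mem_invariantRing_zpowers (by rw [rename_X, Equiv.swap_apply_of_ne_of_ne hi hj])
  obtain ⟨u, hu, h⟩ := exists_smul_grad_mem (G := G) (I := Subgroup.zpowers (Equiv.swap i j)) Q
    fun g hg hgI => by
      -- An element trivial on the `I`-invariants modulo `Q` fixes every index other than `i` and
      -- `j`, since those variables are themselves `I`-invariant; hence it is the identity or the
      -- swap.
      by_contra! hcon
      have hfix (l) (hi : l ≠ i) (hj : l ≠ j) : g l = l := by
        by_contra hgl
        have := hcon _ (hX l hi hj)
        rw [rename_X] at this
        rcases hQ _ _ hgl this with h | h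
        · exact hj h.2
        · exact hi h.2
      have hi : g i = i ∨ g i = j := by
        by_contra! h
        exact h.1 (g.injective (hfix _ h.1 h.2))
      have hj : g j = i ∨ g j = j := by
        by_contra! h
        exact h.2 (g.injective (hfix _ h.1 h.2))
      have hne : g i ≠ g j := fun h => hij (g.injective h)
      rcases hi with hi | hi
      · have hj : g j = j := by
          rcases hj with h | h
          · exact (hne (hi.trans h.symm)).elim
          · exact h
        suffices g = 1 from hgI (this ▸ one_mem _)
        ext1 l
        by_cases h1 : l = i
        · simp [h1, hi]
        by_cases h2 : l = j
        · simp [h2, hj]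
        simp [hfix l h1 h2]
      · have hj : g j = i := by
          rcases hj with h | h
          · exact h
          · exact (hne (hi.trans h.symm)).elim
        suffices g = Equiv.swap i j from hgI (this ▸ Subgroup.mem_zpowers _)
        ext1 l
        by_cases h1 : l = i
        · simp [h1, hi]
        by_cases h2 : l = j
        · simp [h2, hj]
        simp [hfix l h1 h2, Equiv.swap_apply_of_ne_of_ne h1 h2]
  have hadd : u • (Pi.single i 1 + Pi.single j 1 : Fin n → MvPolynomial (Fin n) k) ∈
      gradSpan k G := by
    have := h (X i + X j) (mem_invariantRing_zpowers (by simp [add_comm]))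
    rwa [map_add, grad_X, grad_X] at this
  have hmul : u • ((X i - X j : MvPolynomial (Fin n) k) • Pi.single j 1 :
      Fin n → MvPolynomial (Fin n) k) ∈ gradSpan k G := by
    have := h (X i * X j) (mem_invariantRing_zpowers (by simp [mul_comm]))
    rw [Derivation.leibniz, grad_X, grad_X] at this
    -- `grad (x_i x_j) - x_j grad (x_i + x_j) = (x_i - x_j) e_j`. The matrix `M₂` below has this
    -- vector as row `j`, `e_i + e_j` as row `i`, and unit vectors elsewhere.
    convert sub_mem this (Submodule.smul_mem _ (X j) hadd) using 1
    module
  let M₁ : Matrix (Fin n) (Fin n) (MvPolynomial (Fin n) k) :=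
    Matrix.updateRow 1 i ((1 : Matrix _ _ _) i + (1 : Matrix _ _ _) j)
  let M₂ := Matrix.updateRow M₁ j ((X i - X j : MvPolynomial (Fin n) k) • M₁ j)
  have h1 (l : Fin n) : (1 : Matrix (Fin n) (Fin n) (MvPolynomial (Fin n) k)) l =
      Pi.single l 1 := by
    ext1 m
    simp [Matrix.one_apply, Pi.single_apply, eq_comm]
  have hM₁j : M₁ j = Pi.single j 1 := by
    rw [← h1]
    exact Matrix.updateRow_ne hij.symm
  refine exists_jac_eq_mul_of_smul_mem hu (v := fun l => M₂ l) (fun l => ?_) (X_sub_X_ne_zero hij) ?_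
    fun a ha => X_sub_X_dvd_jac hij hG ha
  · change u • Matrix.updateRow M₁ j _ l ∈ _
    by_cases hj : l = j
    · subst hj
      rwa [Matrix.updateRow_self, hM₁j]
    rw [Matrix.updateRow_ne hj]
    change u • Matrix.updateRow 1 i _ l ∈ _
    by_cases hi : l = i
    · subst hi
      rwa [Matrix.updateRow_self, h1, h1]
    rw [Matrix.updateRow_ne hi, h1, ← grad_X]
    exact h _ (hX l hi hj)
  · change M₂.det = _
    rw [Matrix.det_updateRow_smul, Matrix.updateRow_eq_self, Matrix.det_updateRow_add_self _ hij,
      Matrix.det_one, mul_one]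

variable (k G) in
/-- The product of the linear forms defining the reflecting hyperplanes of `G`. -/
def reflForm : MvPolynomial (Fin n) k :=
  open scoped Classical in
  ∏ p : Fin n × Fin n with p.1 < p.2 ∧ Equiv.swap p.1 p.2 ∈ G, (X p.1 - X p.2)

theorem reflForm_ne_zero : reflForm k G ≠ 0 := by
  classical
  refine Finset.prod_ne_zero_iff.2 fun p hp => X_sub_X_ne_zero (Finset.mem_filter.1 hp).2.1.ne

/-- At each codimension one point, the Jacobian determinants of tuples of invariants generate the
same ideal as the product of the reflecting forms. -/
theorem exists_reflForm_eq_mul {q : MvPolynomial (Fin n) k} (hq : Prime q) :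
    ∃ d e : MvPolynomial (Fin n) k, reflForm k G = d * e ∧ ¬ q ∣ e ∧
      (∀ a : Fin n → MvPolynomial (Fin n) k, (∀ l, a l ∈ invariantRing k G) → d ∣ jac a) ∧
      ∃ a : Fin n → MvPolynomial (Fin n) k, (∀ l, a l ∈ invariantRing k G) ∧
        ∃ c, ¬ q ∣ c ∧ jac a = d * c := by
  classical
  have hassoc {i j : Fin n} (hij : i ≠ j) (h : q ∣ X i - X j) : Associated q (X i - X j) :=
    hq.irreducible.associated_of_dvd (irreducible_X_sub_X hij) h
  have hpair {i j : Fin n} (hij : i ≠ j) (h : q ∣ X i - X j) (l m : Fin n) (hlm : l ≠ m)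
      (h' : q ∣ X l - X m) : l = i ∧ m = j ∨ l = j ∧ m = i :=
    eq_or_eq_of_X_sub_X_dvd hlm ((hassoc hij h).dvd_iff_dvd_left.1 h')
  have : (Ideal.span {q}).IsPrime := (Ideal.span_singleton_prime hq.ne_zero).2 hq
  by_cases hex : ∃ i j : Fin n, i < j ∧ Equiv.swap i j ∈ G ∧ q ∣ X i - X j
  · obtain ⟨i, j, hij, hG, hd⟩ := hex
    refine ⟨X i - X j, _, (Finset.mul_prod_erase _ (fun p : Fin n × Fin n => X p.1 - X p.2)
      (a := (i, j)) (by simp [hij, hG])).symm, ?_, fun a ha => X_sub_X_dvd_jac hij.ne hG ha, ?_⟩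
    · rw [hq.dvd_finsetProd_iff]
      rintro ⟨⟨l, m⟩, hp, hlm⟩
      simp only [Finset.mem_erase, Finset.mem_filter, ne_eq, Prod.mk.injEq] at hp
      rcases hpair hij.ne hd l m hp.2.2.1.ne hlm with h | h
      · exact hp.1 h
      · have := hp.2.2.1
        rw [h.1, h.2] at this
        exact this.asymm hij
    · obtain ⟨a, ha, c, hc, hac⟩ := exists_jac_eq_X_sub_X_mul (G := G) (Q := Ideal.span {q})
        hij.ne hG fun l m hlm h => hpair hij.ne hd l m hlm (Ideal.mem_span_singleton.1 h)
      exact ⟨a, ha, c, by rwa [Ideal.mem_span_singleton] at hc, hac⟩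
  · refine ⟨1, _, (one_mul _).symm, ?_, fun _ _ => one_dvd _, ?_⟩
    · rw [reflForm, hq.dvd_finsetProd_iff]
      rintro ⟨⟨l, m⟩, hp, hlm⟩
      simp only [Finset.mem_filter] at hp
      exact hex ⟨l, m, hp.2.1, hp.2.2, hlm⟩
    · obtain ⟨a, ha, hj⟩ := exists_jac_notMem_of_trivial_inertia (G := G) (Ideal.span {q})
        fun g hg hg1 => by
          -- If `g ≠ 1` is trivial modulo `q`, all differences `x_{g l} - x_l` with `g l ≠ l` are
          -- divisible by `q`, so only one pair of indices is moved. Then `g` is a transposition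
          -- whose form is divisible by `q`, the case already excluded.
          by_contra! hcon
          simp_rw [Ideal.mem_span_singleton] at hcon
          obtain ⟨i, hi⟩ := DFunLike.ne_iff.1 hg1
          change g i ≠ i at hi
          have hfix (l) (hl : g l ≠ l) := hpair hi (hcon i) _ _ hl (hcon l)
          have hgg : g (g i) = i := by
            have h := hfix (g i) fun h => hi (g.injective h)
            rcases h with h | h
            · exact (hi h.2).elim
            · exact h.1
          have hswap : g = Equiv.swap (g i) i := by
            ext1 l
            by_cases h1 : l = g i
            · rw [h1, hgg, Equiv.swap_apply_left]
            by_cases h2 : l = i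
            · rw [h2, Equiv.swap_apply_right]
            rw [Equiv.swap_apply_of_ne_of_ne h1 h2]
            by_contra hl
            rcases hfix l hl with h | h
            · exact h2 h.2
            · exact h1 h.2
          rw [hswap] at hg
          rcases lt_or_gt_of_ne hi with h | h
          · exact hex ⟨_, _, h, hg, hcon i⟩
          · rw [Equiv.swap_comm] at hg
            exact hex ⟨_, _, h, hg, (dvd_sub_comm).1 (hcon i)⟩
      exact ⟨a, ha, jac a, by rwa [Ideal.mem_span_singleton] at hj, (one_mul _).symm⟩

end Jacobian

set_option linter.unusedSectionVars false

/-! ### Orders of fractions at a prime element -/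

section OrderAlongPrime

variable {B L : Type*} [CommRing B] [IsDomain B] [Field L] [Algebra B L] [IsFractionRing B L]

/-- The fraction `x` is a unit of the local ring at the prime element `q`. -/
def IsUnitAt (q : B) (x : L) : Prop :=
  ∃ b c : B, ¬ q ∣ b ∧ ¬ q ∣ c ∧ x = algebraMap B L b / algebraMap B L c

/-- The fraction `x` lies in the local ring at the prime element `q`. -/
def IsIntegralAt (q : B) (x : L) : Prop :=
  ∃ b c : B, ¬ q ∣ c ∧ x = algebraMap B L b / algebraMap B L c

/-- The fraction `x` has order `m` at the prime element `q`. -/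
def HasOrd (q : B) (x : L) (m : ℤ) : Prop :=
  ∃ u : L, IsUnitAt q u ∧ x = algebraMap B L q ^ m * u

variable {q : B} {x y : L} {l m : ℤ}

theorem algebraMap_ne_zero_of_not_dvd {b : B} (hb : ¬ q ∣ b) : algebraMap B L b ≠ 0 := by
  rw [Ne, FaithfulSMul.algebraMap_eq_zero_iff B L]
  rintro rfl
  exact hb (dvd_zero q)

theorem IsUnitAt.ne_zero (hx : IsUnitAt q x) : x ≠ 0 := by
  obtain ⟨b, c, hb, hc, rfl⟩ := hx
  exact div_ne_zero (algebraMap_ne_zero_of_not_dvd hb) (algebraMap_ne_zero_of_not_dvd hc)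

theorem IsUnitAt.isIntegralAt (hx : IsUnitAt q x) : IsIntegralAt q x := by
  obtain ⟨b, c, -, hc, rfl⟩ := hx
  exact ⟨b, c, hc, rfl⟩

theorem IsUnitAt.inv (hx : IsUnitAt q x) : IsUnitAt q x⁻¹ := by
  obtain ⟨b, c, hb, hc, rfl⟩ := hx
  exact ⟨c, b, hc, hb, inv_div _ _⟩

theorem IsUnitAt.mul (hq : Prime q) (hx : IsUnitAt q x) (hy : IsUnitAt q y) :
    IsUnitAt q (x * y) := by
  obtain ⟨b, c, hb, hc, rfl⟩ := hx
  obtain ⟨b', c', hb', hc', rfl⟩ := hy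
  refine ⟨b * b', c * c', ?_, ?_, ?_⟩
  · rw [hq.dvd_mul]; tauto
  · rw [hq.dvd_mul]; tauto
  · rw [map_mul, map_mul, div_mul_div_comm]

theorem isUnitAt_algebraMap (hq : Prime q) {b : B} (hb : ¬ q ∣ b) :
    IsUnitAt q (algebraMap B L b) :=
  ⟨b, 1, hb, fun h => hq.not_isUnit (isUnit_of_dvd_one h), by simp⟩

theorem isUnitAt_one (hq : Prime q) : IsUnitAt q (1 : L) := by
  simpa using isUnitAt_algebraMap (L := L) hq (b := 1) fun h => hq.not_isUnit (isUnit_of_dvd_one h)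

theorem IsUnitAt.pow (hq : Prime q) (hx : IsUnitAt q x) (r : ℕ) : IsUnitAt q (x ^ r) := by
  induction r with
  | zero => simpa using isUnitAt_one hq
  | succ r ih => rw [pow_succ]; exact ih.mul hq hx

theorem isIntegralAt_algebraMap (hq : Prime q) (b : B) : IsIntegralAt q (algebraMap B L b) :=
  ⟨b, 1, fun h => hq.not_isUnit (isUnit_of_dvd_one h), by simp⟩

theorem IsIntegralAt.mul (hq : Prime q) (hx : IsIntegralAt q x) (hy : IsIntegralAt q y) :
    IsIntegralAt q (x * y) := by
  obtain ⟨b, c, hc, rfl⟩ := hx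
  obtain ⟨b', c', hc', rfl⟩ := hy
  refine ⟨b * b', c * c', ?_, ?_⟩
  · rw [hq.dvd_mul]; tauto
  · rw [map_mul, map_mul, div_mul_div_comm]

theorem isUnitAt_of_mul_eq_one (hq : Prime q) (hx : IsIntegralAt q x) (hy : IsIntegralAt q y)
    (hxy : x * y = 1) : IsUnitAt q x := by
  obtain ⟨b, c, hc, rfl⟩ := hx
  obtain ⟨b', c', hc', rfl⟩ := hy
  refine ⟨b, c, fun hb => ?_, hc, rfl⟩
  have h1 := algebraMap_ne_zero_of_not_dvd (L := L) hc
  have h2 := algebraMap_ne_zero_of_not_dvd (L := L) hc'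
  rw [div_mul_div_comm, div_eq_one_iff_eq (mul_ne_zero h1 h2), ← map_mul, ← map_mul] at hxy
  have := IsFractionRing.injective B L hxy
  have h3 : q ∣ c * c' := this ▸ hb.mul_right b'
  rw [hq.dvd_mul] at h3
  tauto

theorem HasOrd.isUnitAt (hx : HasOrd q x 0) : IsUnitAt q x := by
  obtain ⟨u, hu, rfl⟩ := hx
  simpa using hu

theorem IsUnitAt.hasOrd (hx : IsUnitAt q x) : HasOrd q x 0 := ⟨x, hx, by simp⟩

theorem HasOrd.ne_zero (hq : Prime q) (hx : HasOrd q x m) : x ≠ 0 := by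
  obtain ⟨u, hu, rfl⟩ := hx
  exact mul_ne_zero (zpow_ne_zero _ fun h =>
    hq.ne_zero ((FaithfulSMul.algebraMap_eq_zero_iff B L).1 h)) hu.ne_zero

theorem HasOrd.mul (hq : Prime q) (hx : HasOrd q x l) (hy : HasOrd q y m) :
    HasOrd q (x * y) (l + m) := by
  obtain ⟨u, hu, rfl⟩ := hx
  obtain ⟨v, hv, rfl⟩ := hy
  refine ⟨u * v, hu.mul hq hv, ?_⟩
  rw [zpow_add₀ fun h => hq.ne_zero ((FaithfulSMul.algebraMap_eq_zero_iff B L).1 h)]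
  ring

theorem HasOrd.inv (hx : HasOrd q x m) : HasOrd q x⁻¹ (-m) := by
  obtain ⟨u, hu, rfl⟩ := hx
  exact ⟨u⁻¹, hu.inv, by rw [mul_inv, zpow_neg]⟩

theorem HasOrd.zpow (hx : HasOrd q x m) (hq : Prime q) (r : ℤ) : HasOrd q (x ^ r) (r * m) := by
  have hpow (r : ℕ) : HasOrd q (x ^ r) (r * m) := by
    induction r with
    | zero => simpa using (isUnitAt_one hq).hasOrd
    | succ r ih =>
      rw [pow_succ]
      convert ih.mul hq hx using 1
      push_cast; ring
  obtain ⟨r, rfl | rfl⟩ := r.eq_nat_or_neg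
  · simpa using hpow r
  · simpa using (hpow r).inv

theorem HasOrd.isIntegralAt (hq : Prime q) (hm : 0 ≤ m) (hx : HasOrd q x m) :
    IsIntegralAt q x := by
  obtain ⟨u, hu, rfl⟩ := hx
  lift m to ℕ using hm
  rw [zpow_natCast, ← map_pow]
  exact (isIntegralAt_algebraMap hq _).mul hq hu.isIntegralAt

theorem HasOrd.pos_of_dvd (hq : Prime q) {b : B} (hx : HasOrd q (algebraMap B L b) m)
    (hb : q ∣ b) : 0 < m := by
  by_contra! hm
  have hu : IsUnitAt q (algebraMap B L b) := by
    refine isUnitAt_of_mul_eq_one hq (isIntegralAt_algebraMap hq b)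
      (hx.inv.isIntegralAt hq (by lia)) (mul_inv_cancel₀ (hx.ne_zero hq))
  obtain ⟨c, d, hc, hd, h⟩ := hu
  rw [eq_div_iff (algebraMap_ne_zero_of_not_dvd hd), ← map_mul] at h
  exact hc (IsFractionRing.injective B L h ▸ hb.mul_right d)

theorem HasOrd.dvd_of_pos (hq : Prime q) {b : B} (hx : HasOrd q (algebraMap B L b) m)
    (hm : 0 < m) : q ∣ b := by
  obtain ⟨u, ⟨c, d, hc, hd, rfl⟩, h⟩ := hx
  lift m to ℕ using hm.le
  have hd0 := algebraMap_ne_zero_of_not_dvd (L := L) hd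
  rw [zpow_natCast, mul_div_assoc', eq_div_iff hd0, ← map_pow, ← map_mul, ← map_mul] at h
  have h := IsFractionRing.injective B L h
  have : q ∣ b * d := h ▸ (dvd_pow_self q (by lia)).mul_right c
  exact (hq.dvd_mul.1 this).resolve_right hd

theorem exists_hasOrd [WfDvdMonoid B] (hq : Prime q) (hx : x ≠ 0) : ∃ m, HasOrd q x m := by
  have hB (b : B) (hb : b ≠ 0) : ∃ m, HasOrd q (algebraMap B L b) m := by
    obtain ⟨m, c, hc, rfl⟩ := WfDvdMonoid.max_power_factor hb hq.irreducible
    exact ⟨m, algebraMap B L c, isUnitAt_algebraMap hq hc, by simp⟩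
  obtain ⟨b, c, hc, rfl⟩ := IsFractionRing.div_surjective B x
  obtain ⟨l, hl⟩ := hB b (by rintro rfl; simp at hx)
  obtain ⟨m, hm⟩ := hB c (nonZeroDivisors.ne_zero hc)
  exact ⟨l + -m, by rw [div_eq_mul_inv]; exact hl.mul hq hm.inv⟩

end OrderAlongPrime

/-! ### Local rings of the quotient at prime divisors, seen from the cover -/

section Quotient

variable {A B L : Type*} [CommRing A] [IsDomain A] [CommRing B] [IsDomain B]
  [UniqueFactorizationMonoid B] [Algebra A B] [FaithfulSMul A B] [Field L] [Algebra B L]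
  [IsFractionRing B L] [Algebra A L] [IsScalarTower A B L] [Algebra (FractionRing A) L]
  [IsScalarTower A (FractionRing A) L]

/-- The prime element `q` generates a prime lying over `P`. -/
def LiesOver (q : B) (P : PrimeDivisor A) : Prop :=
  ∀ a : A, a ∈ P.1.asIdeal ↔ q ∣ algebraMap A B a

variable (B) in
-- Lying over gives a nonzero prime above `P`, which contains a prime element `q` as `B` is
-- factorial. By integrality `(q)` contracts to a nonzero prime inside `P`, which is `P` because `P`
-- has height one; going down is not needed.
theorem exists_prime_liesOver [Algebra.IsIntegral A B] (P : PrimeDivisor A) :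
    ∃ q : B, Prime q ∧ LiesOver q P := by
  obtain ⟨Q, -, hQ, hQP⟩ := Ideal.exists_ideal_over_prime_of_isIntegral P.1.asIdeal
    (⊥ : Ideal B) fun a ha => by
      rw [Ideal.mem_comap, Ideal.mem_bot, FaithfulSMul.algebraMap_eq_zero_iff] at ha
      rw [ha]
      exact zero_mem _
  have hP0 : P.1.asIdeal ≠ ⊥ := Ideal.ne_bot_of_height_eq_one P.2
  obtain ⟨q, hqQ, hq⟩ := hQ.exists_mem_prime_of_ne_bot fun h => hP0 <| by
    rw [← hQP, h, eq_bot_iff]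
    intro a ha
    rwa [Ideal.mem_comap, Ideal.mem_bot, FaithfulSMul.algebraMap_eq_zero_iff] at ha
  have hqp : (Ideal.span {q}).IsPrime := (Ideal.span_singleton_prime hq.ne_zero).2 hq
  have hle : (Ideal.span {q}).comap (algebraMap A B) ≤ P.1.asIdeal := by
    rw [← hQP]
    exact Ideal.comap_mono ((Ideal.span_singleton_le_iff_mem _).2 hqQ)
  have hne : (Ideal.span {q}).comap (algebraMap A B) ≠ ⊥ :=
    Ideal.comap_ne_bot_of_integral_mem hq.ne_zero (Ideal.mem_span_singleton_self q)
      (Algebra.IsIntegral.isIntegral q)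
  have heq : (Ideal.span {q}).comap (algebraMap A B) = P.1.asIdeal := by
    by_contra hlt
    have h1 := Ideal.height_add_one_le_of_lt_of_isPrime (lt_of_le_of_ne hle hlt)
    rw [P.2] at h1
    refine hne (Ideal.height_eq_zero_iff_eq_bot.1 ?_)
    by_contra h0
    have h2 : 1 ≤ ((Ideal.span {q}).comap (algebraMap A B)).height :=
      Order.one_le_iff_ne_zero.2 h0
    have h3 : (1 : ℕ∞) + 1 ≤ 1 := (by gcongr : (1 : ℕ∞) + 1 ≤ _ + 1).trans h1
    norm_num at h3
  refine ⟨q, hq, fun a => ?_⟩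
  rw [← heq, Ideal.mem_comap, Ideal.mem_span_singleton]

section LocalRing

variable {P : PrimeDivisor A} {q : B}

theorem mem_localRing_iff {f : FractionRing A} :
    f ∈ localRing P.1 ↔ ∃ a s : A, s ∉ P.1.asIdeal ∧
      f = algebraMap _ _ a / algebraMap _ _ s := by
  simp_rw [div_eq_mul_inv]
  exact ⟨fun ⟨a, s, hs, h⟩ => ⟨a, s, hs, h⟩, fun ⟨a, s, hs, h⟩ => ⟨a, s, hs, h⟩⟩

theorem algebraMap_algebraMap (a : A) :
    algebraMap (FractionRing A) L
      (algebraMap _ _ a) = algebraMap B L (algebraMap A B a) := by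
  rw [← IsScalarTower.algebraMap_apply, ← IsScalarTower.algebraMap_apply]

theorem isIntegralAt_of_mem_localRing (hP : LiesOver q P) {f : FractionRing A}
    (hf : f ∈ localRing P.1) :
    IsIntegralAt q (algebraMap _ L f) := by
  obtain ⟨a, s, hs, rfl⟩ := mem_localRing_iff.1 hf
  refine ⟨algebraMap A B a, algebraMap A B s, fun h => hs ((hP s).2 h), ?_⟩
  rw [map_div₀, algebraMap_algebraMap (B := B), algebraMap_algebraMap (B := B)]

/-- Write `f = b / c` in lowest terms. Since `f` is `G`-fixed, the conjugates of `c` are all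
associated to `c`, hence prime to `q`. So the norm `N` of `c` lies outside `P`, while `f * N` is an
invariant element of `B`: integrality at one prime over `P` suffices. -/
theorem mem_localRing_of_isIntegralAt (G : Type*) [Group G] [Finite G] [MulSemiringAction G B]
    [IsGaloisGroup G A B] (hq : Prime q) (hP : LiesOver q P) {f : FractionRing A}
    (hf : IsIntegralAt q (algebraMap _ L f)) : f ∈ localRing P.1 := by
  classical
  have := Fintype.ofFinite G
  set x := algebraMap _ L f with hx
  set b := IsFractionRing.num B x with hb
  set c := (IsFractionRing.den B x : B) with hc
  have hc0 : c ≠ 0 := nonZeroDivisors.coe_ne_zero _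
  have hbc : IsRelPrime b c := IsFractionRing.num_den_reduced _ x
  have hinj := IsFractionRing.injective B L
  have hinjA := FaithfulSMul.algebraMap_injective A B
  have hL {y : B} (hy : y ≠ 0) : algebraMap _ L y ≠ 0 := by
    rwa [Ne, FaithfulSMul.algebraMap_eq_zero_iff]
  have hxbc : algebraMap _ _ b / algebraMap _ _ c = x := IsFractionRing.mk'_num_den' _ x
  have hqc : ¬ q ∣ c := by
    obtain ⟨b', c', hc', h⟩ := hf
    rw [← hxbc, div_eq_div_iff (hL hc0) (algebraMap_ne_zero_of_not_dvd hc'), ← map_mul,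
      ← map_mul] at h
    have h := hinj h
    intro hqc
    refine hc' (hqc.trans (hbc.symm.dvd_of_dvd_mul_left (z := c') ?_))
    rw [h]
    exact dvd_mul_left _ _
  obtain ⟨a, s, hs, hf⟩ := IsFractionRing.div_surjective A f
  have hs0 : algebraMap A B s ≠ 0 := by
    rw [Ne, FaithfulSMul.algebraMap_eq_zero_iff]
    exact nonZeroDivisors.ne_zero hs
  have hcross : algebraMap A B s * b = algebraMap A B a * c := by
    rw [hx, ← hf, map_div₀, algebraMap_algebraMap (B := B), algebraMap_algebraMap (B := B),
      div_eq_div_iff (hL hc0) (hL hs0), ← map_mul, ← map_mul] at hxbc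
    rw [← hinj hxbc, mul_comm]
  have hdvd (σ : G) : c ∣ σ • c := by
    have h := congrArg (σ • ·) hcross
    simp only [smul_mul', smul_algebraMap] at h
    refine hbc.symm.dvd_of_dvd_mul_left (z := σ • c) ⟨σ • b, ?_⟩
    refine mul_left_cancel₀ hs0 ?_
    linear_combination (σ • c) * hcross - c * h
  have hqσ (σ : G) : ¬ q ∣ σ • c := by
    intro h
    refine hqc (h.trans ?_)
    have := map_dvd (MulSemiringAction.toRingHom G B σ) (hdvd σ⁻¹)
    rwa [MulSemiringAction.toRingHom_apply, MulSemiringAction.toRingHom_apply,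
      smul_inv_smul] at this
  obtain ⟨N, hN⟩ := Algebra.IsInvariant.isInvariant (A := A) (G := G) (∏ σ : G, σ • c) fun τ => by
    rw [Finset.smul_prod']
    exact Fintype.prod_equiv (Equiv.mulLeft τ) _ _ fun σ => (mul_smul _ _ _).symm
  let c' := ∏ σ ∈ Finset.univ.erase (1 : G), σ • c
  have hNc : algebraMap A B N = c * c' := by
    rw [hN, ← Finset.mul_prod_erase _ _ (Finset.mem_univ (1 : G)), one_smul]
  have hqN : ¬ q ∣ algebraMap A B N := by
    rw [hN, hq.dvd_finsetProd_iff]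
    rintro ⟨σ, -, h⟩
    exact hqσ σ h
  have hsb : algebraMap A B s * (b * c') = algebraMap A B a * algebraMap A B N := by
    rw [hNc]; linear_combination c' * hcross
  obtain ⟨t, ht⟩ := Algebra.IsInvariant.isInvariant (A := A) (G := G) (b * c') fun σ => by
    refine mul_left_cancel₀ hs0 ?_
    have := congrArg (σ • ·) hsb
    rw [smul_mul', smul_mul' σ (algebraMap A B a), smul_algebraMap, smul_algebraMap,
      smul_algebraMap] at this
    rw [this, hsb]
  have hst : s * t = a * N := hinjA (by rw [map_mul, map_mul, ht, hsb])
  refine mem_localRing_iff.2 ⟨t, N, fun h => hqN ((hP N).1 h), ?_⟩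
  have hN0 : N ≠ 0 := fun h => hqN (by rw [h, map_zero]; exact dvd_zero q)
  rw [← hf, div_eq_div_iff, ← map_mul, ← map_mul, ← hst, mul_comm]
  · rw [Ne, FaithfulSMul.algebraMap_eq_zero_iff]
    exact nonZeroDivisors.ne_zero hs
  · rwa [Ne, FaithfulSMul.algebraMap_eq_zero_iff]

variable (L) in
-- The orders at `q` of nonzero elements of the function field of `A` form a subgroup `dℤ`, with `d
-- > 0` because `P ≠ 0`. Any element of order `d` is a uniformizer; `d` plays the role of the
-- ramification index.
theorem exists_isUniformizer (G : Type*) [Group G] [Finite G] [MulSemiringAction G B]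
    [IsGaloisGroup G A B] (hq : Prime q) (hP : LiesOver q P) :
    ∃ ϖ : localRing P.1, IsUniformizer P ϖ ∧ ∀ f : FractionRing A, f ≠ 0 →
      ∃ (m : ℤ) (u : FractionRing A),
        IsUnitAt q (algebraMap _ L u) ∧
          f = (ϖ : FractionRing A) ^ m * u := by
  let ι := algebraMap (FractionRing A) L
  have hι (f) (hf : f ≠ 0) : ι f ≠ 0 := (map_ne_zero ι).2 hf
  let H : AddSubgroup ℤ :=
    { carrier := {m | ∃ f, HasOrd q (ι f) m}
      zero_mem' := ⟨1, by rw [map_one]; exact (isUnitAt_one hq).hasOrd⟩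
      add_mem' := by
        rintro l m ⟨f, hf⟩ ⟨g, hg⟩
        exact ⟨f * g, by rw [map_mul]; exact hf.mul hq hg⟩
      neg_mem' := by
        rintro m ⟨f, hf⟩
        exact ⟨f⁻¹, by rw [map_inv₀]; exact hf.inv⟩ }
  obtain ⟨d₀, hd₀⟩ := Int.subgroup_cyclic H
  rw [← AddSubgroup.zmultiples_eq_closure, ← Int.zmultiples_natAbs] at hd₀
  set d : ℤ := (d₀.natAbs : ℤ) with hd
  obtain ⟨w, hw⟩ : ∃ f, HasOrd q (ι f) d := by
    change d ∈ H
    rw [hd₀]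
    exact AddSubgroup.mem_zmultiples d
  have hmul (f) (hf : f ≠ 0) : ∃ m : ℤ, HasOrd q (ι f) (m * d) := by
    obtain ⟨m, hm⟩ := exists_hasOrd hq (hι f hf)
    have : m ∈ H := ⟨f, hm⟩
    rw [hd₀, AddSubgroup.mem_zmultiples_iff] at this
    obtain ⟨r, rfl⟩ := this
    exact ⟨r, by simpa using hm⟩
  have hw0 : w ≠ 0 := by
    rintro rfl
    exact hw.ne_zero hq (map_zero ι)
  have hfac (f) (m : ℤ) (hf : HasOrd q (ι f) (m * d)) : IsUnitAt q (ι (w ^ (-m) * f)) := by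
    refine HasOrd.isUnitAt ?_
    rw [map_mul, map_zpow₀]
    convert (hw.zpow hq (-m)).mul hq hf using 1
    ring
  have hwmem : w ∈ localRing P.1 :=
    mem_localRing_of_isIntegralAt G hq hP (hw.isIntegralAt hq (by simp [hd]))
  obtain ⟨p, hpP, hp0⟩ := Submodule.exists_mem_ne_zero_of_ne_bot (Ideal.ne_bot_of_height_eq_one P.2)
  have hdpos : 0 < d := by
    obtain ⟨m, hm⟩ := hmul (algebraMap _ _ p) (by rwa [Ne, FaithfulSMul.algebraMap_eq_zero_iff])
    change HasOrd q (algebraMap _ _ _) _ at hm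
    rw [algebraMap_algebraMap (B := B)] at hm
    have h := hm.pos_of_dvd hq ((hP p).1 hpP)
    have : d ≠ 0 := by rintro h0; rw [h0] at h; simp at h
    have : 0 ≤ d := by simp [hd]
    lia
  refine ⟨⟨w, hwmem⟩, ⟨fun h => hw0 (congrArg Subtype.val h), le_antisymm ?_ ?_⟩, ?_⟩
  · rw [Ideal.span_singleton_le_iff_mem]
    obtain ⟨a, s, hs, has⟩ := mem_localRing_iff.1 hwmem
    have hqs : ¬ q ∣ algebraMap A B s := fun h => hs ((hP s).2 h)
    have hs0 : algebraMap _ (FractionRing A) s ≠ 0 := by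
      rw [Ne, FaithfulSMul.algebraMap_eq_zero_iff]
      rintro rfl
      exact hqs (by rw [map_zero]; exact dvd_zero q)
    have ha : a ∈ P.1.asIdeal := by
      refine (hP a).2 (HasOrd.dvd_of_pos hq (m := d) (L := L) ?_ hdpos)
      have h1 := hw.mul hq (isUnitAt_algebraMap (L := L) hq hqs).hasOrd
      rw [add_zero, ← algebraMap_algebraMap (B := B), ← map_mul, has, div_mul_cancel₀ _ hs0] at h1
      rwa [← algebraMap_algebraMap (B := B)]
    have hinv : (algebraMap _ (FractionRing A) s)⁻¹ ∈ localRing P.1 :=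
      mem_localRing_iff.2 ⟨1, s, hs, by simp⟩
    have : (⟨w, hwmem⟩ : localRing P.1) = ⟨_, hinv⟩ * algebraMap _ (localRing P.1) a := by
      ext
      change w = _⁻¹ * algebraMap _ _ a
      rw [has, div_eq_inv_mul]
    rw [this]
    exact Ideal.mul_mem_left _ _ (Ideal.mem_map_of_mem _ ha)
  · rw [Ideal.map_le_iff_le_comap]
    intro a ha
    rw [Ideal.mem_comap, Ideal.mem_span_singleton]
    by_cases ha0 : a = 0
    · rw [ha0, map_zero]; exact dvd_zero _
    obtain ⟨m, hm⟩ := hmul (algebraMap _ _ a) (by rwa [Ne, FaithfulSMul.algebraMap_eq_zero_iff])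
    have hm1 : 0 < m * d := by
      have h := hm
      change HasOrd q (algebraMap _ _ _) _ at h
      rw [algebraMap_algebraMap (B := B)] at h
      exact h.pos_of_dvd hq ((hP a).1 ha)
    have hm0 : 0 < m := pos_of_mul_pos_left hm1 hdpos.le
    have hmem : w⁻¹ * algebraMap _ _ a ∈ localRing P.1 := by
      refine mem_localRing_of_isIntegralAt (L := L) G hq hP (HasOrd.isIntegralAt hq (m := (m - 1) * d)
        (mul_nonneg (by lia) hdpos.le) ?_)
      rw [map_mul, map_inv₀]
      convert hw.inv.mul hq hm using 1
      ring
    refine ⟨⟨_, hmem⟩, Subtype.ext ?_⟩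
    change algebraMap _ _ a = w * (w⁻¹ * algebraMap _ _ a)
    rw [mul_inv_cancel_left₀ hw0]
  · intro f hf
    obtain ⟨m, hm⟩ := hmul f hf
    exact ⟨m, _, hfac f m hm, by
      change f = w ^ m * _
      rw [← mul_assoc, ← zpow_add₀ hw0, add_neg_cancel, zpow_zero, one_mul]⟩

end LocalRing

end Quotient

/-! ### Top forms and their coordinate upstairs -/

section DifferentialForms

variable (k : Type*) [Field k] {A B L : Type*} [CommRing A] [IsDomain A] [CommRing B] [IsDomain B]
  [UniqueFactorizationMonoid B] [Algebra A B] [FaithfulSMul A B] [Field L] [Algebra B L]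
  [IsFractionRing B L] [Algebra A L] [IsScalarTower A B L] [Algebra (FractionRing A) L]
  [IsScalarTower A (FractionRing A) L] [Algebra k A] [Algebra k B] [IsScalarTower k A B]
  [Algebra k L] [IsScalarTower k B L] [IsScalarTower k (FractionRing A) L] {n : ℕ}
  (b : Module.Basis (Fin n) B (Ω[B⁄k]))

/-- The basis of the differentials of the fraction field induced by one of the ring. -/
def fractionBasis (L : Type*) [Field L] [Algebra B L] [IsFractionRing B L] [Algebra k L]
    [IsScalarTower k B L] : Module.Basis (Fin n) L (Ω[L⁄k]) :=
  haveI : Algebra.FormallyEtale B L := .of_isLocalization (nonZeroDivisors B)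
  (b.baseChange L).map (KaehlerDifferential.tensorKaehlerEquivOfFormallyEtale k B L)

theorem fractionBasis_repr (f : B) (i : Fin n) :
    (fractionBasis k b L).repr (KaehlerDifferential.D k L (algebraMap B L f)) i =
      algebraMap B L (b.repr (KaehlerDifferential.D k B f) i) := by
  have : Algebra.FormallyEtale B L := .of_isLocalization (nonZeroDivisors B)
  rw [fractionBasis, Module.Basis.map_repr, LinearEquiv.trans_apply,
    KaehlerDifferential.tensorKaehlerEquivOfFormallyEtale_symm_D_algebraMap,
    Module.Basis.baseChange_repr_tmul, Algebra.smul_def, mul_one]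

variable (L) in
/-- The coordinates of a differential of the smaller field with respect to a basis of the
differentials of the larger one. -/
def coordForms : Ω[FractionRing A⁄k] →ₗ[FractionRing A] (Fin n → L) :=
  ((fractionBasis k b L).equivFun.restrictScalars (FractionRing A)).toLinearMap ∘ₗ
    KaehlerDifferential.map k k (FractionRing A) L

theorem coordForms_D (a : A) (i : Fin n) :
    coordForms k L b (KaehlerDifferential.D k (FractionRing A) (algebraMap _ _ a)) i =
      algebraMap B L (b.repr (KaehlerDifferential.D k B (algebraMap A B a)) i) := by
  rw [← fractionBasis_repr k b]
  change (fractionBasis k b L).repr (KaehlerDifferential.map k k (FractionRing A) L _) i = _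
  rw [KaehlerDifferential.map_D, algebraMap_algebraMap (B := B)]

/-- The Jacobian determinant of a tuple of elements with respect to a basis of differentials. -/
def jacobian (a : Fin n → A) : B :=
  Matrix.det (Matrix.of fun i j => b.repr (KaehlerDifferential.D k B (algebraMap A B (a i))) j)

variable (L) in
/-- The coordinate of a top form of the smaller field with respect to a basis of differentials of
the larger one. -/
def coordTopForms : ⋀[FractionRing A]^n (Ω[FractionRing A⁄k]) →ₗ[FractionRing A] L :=
  exteriorPower.alternatingMapLinearEquiv
    { ((Matrix.detRowAlternating (n := Fin n) (R := L)).toMultilinearMap.restrictScalars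
        (FractionRing A)).compLinearMap fun _ => coordForms k L b with
      map_eq_zero_of_eq' := fun v i j hv hij =>
        (Matrix.detRowAlternating (n := Fin n) (R := L)).map_eq_zero_of_eq
          (fun l => coordForms k L b (v l)) (by simp only [hv]) hij }

/-- The form `da_1 ∧ ⋯ ∧ da_n`. -/
def wedgeD (a : Fin n → A) : ⋀[FractionRing A]^n (Ω[FractionRing A⁄k]) :=
  exteriorPower.ιMulti (FractionRing A) n
    fun i => KaehlerDifferential.D k (FractionRing A) (algebraMap A (FractionRing A) (a i))

theorem coordTopForms_wedgeD (a : Fin n → A) :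
    coordTopForms k L b (wedgeD k a) = algebraMap B L (jacobian k b a) := by
  rw [coordTopForms, wedgeD, exteriorPower.alternatingMapLinearEquiv_apply_ιMulti, jacobian,
    RingHom.map_det]
  change Matrix.det _ = _
  congr 1
  ext i j
  exact coordForms_D k b (a i) j

variable (A) in
-- A separable algebraic extension is formally étale, so the differentials of `L` are the base
-- change of those of the smaller field.
theorem rank_differentials (L : Type*) [Field L] [Algebra B L] [IsFractionRing B L]
    [Algebra k L] [IsScalarTower k B L] [Algebra (FractionRing A) L]
    [IsScalarTower k (FractionRing A) L] [Algebra.IsSeparable (FractionRing A) L]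
    (b : Module.Basis (Fin n) B (Ω[B⁄k])) :
     Module.rank (FractionRing A) (Ω[FractionRing A⁄k]) = n := by
  have : Algebra.FormallyEtale (FractionRing A) L := .of_isSeparable _ _
  have h := ((fractionBasis k b L).map
    (KaehlerDifferential.tensorKaehlerEquivOfFormallyEtale k (FractionRing A) L).symm).mk_eq_rank
  rw [Module.rank_baseChange] at h
  simpa using h.symm

variable (A) in
theorem finrank_topForms (L : Type*) [Field L] [Algebra B L] [IsFractionRing B L]
    [Algebra k L] [IsScalarTower k B L] [Algebra (FractionRing A) L]
    [IsScalarTower k (FractionRing A) L] [Algebra.IsSeparable (FractionRing A) L]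
    (b : Module.Basis (Fin n) B (Ω[B⁄k])) :
    
    Module.finrank (FractionRing A) (⋀[FractionRing A]^n (Ω[FractionRing A⁄k])) = 1 := by
  have h := rank_differentials k A L b
  have : Module.Finite (FractionRing A) (Ω[FractionRing A⁄k]) := by
    rw [← Module.rank_lt_aleph0_iff, h]
    exact Cardinal.natCast_lt_aleph0
  rw [exteriorPower.finrank_eq, Module.finrank_eq_of_rank_eq h, Nat.choose_self]

end DifferentialForms

/-! ### Canonical divisors and their multiples -/

section Gorenstein

variable (k : Type*) [Field k] {A B L : Type*} [CommRing A] [IsDomain A] [CommRing B] [IsDomain B]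
  [UniqueFactorizationMonoid B] [Algebra A B] [FaithfulSMul A B] [Field L] [Algebra B L]
  [IsFractionRing B L] [Algebra A L] [IsScalarTower A B L] [Algebra (FractionRing A) L]
  [IsScalarTower A (FractionRing A) L] [Algebra k A] [Algebra k B] [IsScalarTower k A B]
  [Algebra k L] [IsScalarTower k B L] [IsScalarTower k (FractionRing A) L] {n : ℕ}
  (b : Module.Basis (Fin n) B (Ω[B⁄k])) {Δ : B} {P : PrimeDivisor A} {q : B}

variable (A) in
/-- At every prime element, the Jacobian determinants of tuples of elements of `A` generate the
same ideal as `Δ`. -/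
def IsJacobianDivisor (Δ : B) : Prop :=
  Δ ≠ 0 ∧ ∀ q : B, Prime q → ∃ d e : B, Δ = d * e ∧ ¬ q ∣ e ∧
    (∀ a : Fin n → A, d ∣ jacobian k b a) ∧
      ∃ (a : Fin n → A) (c : B), ¬ q ∣ c ∧ jacobian k b a = d * c

/-- The quotient rule. It lets the regular forms be generated by wedges of differentials of elements
of `A`. -/
theorem D_mem_span_of_mem_localRing {f : FractionRing A} (hf : f ∈ localRing P.1) :
    KaehlerDifferential.D k (FractionRing A) f ∈ Submodule.span (localRing P.1)
      (Set.range fun a : A => KaehlerDifferential.D k (FractionRing A) (algebraMap _ _ a)) := by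
  obtain ⟨a, s, hs, rfl⟩ := mem_localRing_iff.1 hf
  have hinv : (algebraMap _ (FractionRing A) s)⁻¹ ∈ localRing P.1 :=
    mem_localRing_iff.2 ⟨1, s, hs, by simp⟩
  have hmem (x : A) : algebraMap _ (FractionRing A) x ∈ localRing P.1 :=
    (localRing P.1).algebraMap_mem x
  rw [Derivation.leibniz_div]
  set S := Submodule.span (localRing P.1)
    (Set.range fun a : A => KaehlerDifferential.D k (FractionRing A) (algebraMap _ _ a))
  have hsmul {g : FractionRing A} (hg : g ∈ localRing P.1) {x} (hx : x ∈ S) : g • x ∈ S :=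
    Submodule.smul_mem S (⟨g, hg⟩ : localRing P.1) hx
  exact hsmul (pow_mem hinv 2) (sub_mem (hsmul (hmem s) (Submodule.subset_span ⟨a, rfl⟩))
    (hsmul (hmem a) (Submodule.subset_span ⟨s, rfl⟩)))

theorem regularForms_eq_span_wedgeD (P : PrimeDivisor A) :
    regularForms k n P = Submodule.span (localRing P.1) (Set.range (wedgeD k (n := n))) := by
  refine le_antisymm ?_ ?_
  · rw [regularForms, Submodule.span_le]
    rintro _ ⟨f, rfl⟩
    have h := multilinearMap_apply_mem_span
      ((exteriorPower.ιMulti (FractionRing A) n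
        (M := Ω[FractionRing A⁄k])).toMultilinearMap.restrictScalars (localRing P.1))
      fun i => D_mem_span_of_mem_localRing k (f i).2
    refine Submodule.span_mono ?_ h
    rintro _ ⟨w, hw, rfl⟩
    choose a ha using hw
    obtain rfl := funext ha
    exact ⟨a, rfl⟩
  · refine Submodule.span_mono ?_
    rintro _ ⟨a, rfl⟩
    exact ⟨fun i => algebraMap A (localRing P.1) (a i), rfl⟩

variable [Algebra.IsSeparable (FractionRing A) L]

variable (L) in
/-- At the generic point of a prime divisor, the regular top forms are generated by a form whose
coordinate upstairs is `Δ` up to a unit. -/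
theorem exists_regularForms_eq_span (G : Type*) [Group G] [Finite G] [MulSemiringAction G B]
    [IsGaloisGroup G A B] (hΔ : IsJacobianDivisor k A b Δ) (hq : Prime q) (hP : LiesOver q P) :
    ∃ η, regularForms k n P = Submodule.span (localRing P.1) {η} ∧
      ∃ u, IsUnitAt q u ∧ coordTopForms k L b η = algebraMap B L Δ * u := by
  obtain ⟨hΔ0, hΔ⟩ := hΔ
  obtain ⟨d, e, rfl, he, hd, a, c, hc, hac⟩ := hΔ q hq
  have hd0 : algebraMap B L d ≠ 0 := by
    rw [Ne, FaithfulSMul.algebraMap_eq_zero_iff]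
    exact left_ne_zero_of_mul hΔ0
  have he0 := algebraMap_ne_zero_of_not_dvd (L := L) he
  have hc0 := algebraMap_ne_zero_of_not_dvd (L := L) hc
  have hη : coordTopForms k L b (wedgeD k a) = algebraMap B L d * algebraMap B L c := by
    rw [coordTopForms_wedgeD, hac, map_mul]
  have hη0 : wedgeD k a ≠ 0 := by
    intro h
    rw [h, map_zero] at hη
    exact mul_ne_zero hd0 hc0 hη.symm
  refine ⟨wedgeD k a, le_antisymm ?_ ?_, algebraMap B L c / algebraMap B L e, ⟨c, e, hc, he, rfl⟩,
    ?_⟩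
  · rw [regularForms_eq_span_wedgeD, Submodule.span_le]
    rintro _ ⟨a', rfl⟩
    obtain ⟨g, hg⟩ := (finrank_eq_one_iff_of_nonzero' _ hη0).1 (finrank_topForms k A L b)
      (wedgeD k a')
    obtain ⟨c', hc'⟩ := hd a'
    have h := congrArg (coordTopForms k L b) hg
    rw [map_smul, hη, coordTopForms_wedgeD, hc', map_mul, Algebra.smul_def] at h
    -- Comparing coordinates gives `g * (d * c) = d * c'`, so `g = c' / c` with `c` prime to `q`.
    have hgmem : g ∈ localRing P.1 := by
      refine mem_localRing_of_isIntegralAt (L := L) G hq hP ⟨c', c, hc, ?_⟩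
      rw [eq_div_iff hc0]
      exact mul_left_cancel₀ hd0 (by linear_combination h)
    exact Submodule.mem_span_singleton.2 ⟨⟨g, hgmem⟩, hg⟩
  · rw [regularForms_eq_span_wedgeD, Submodule.span_singleton_le_iff_mem]
    exact Submodule.subset_span ⟨a, rfl⟩
  · rw [hη, map_mul]
    field_simp

theorem exists_eq_smul_of_span_singleton_eq {R M : Type*} [CommRing R] [AddCommGroup M] [Module R M]
    {x y : M} (h : Submodule.span R {x} = Submodule.span R {y}) : ∃ r : R, x = r • y := by
  obtain ⟨r, hr⟩ := Submodule.mem_span_singleton.1 (h ▸ Submodule.mem_span_singleton_self x)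
  exact ⟨r, hr.symm⟩

/-- The form `da_1 ∧ ⋯ ∧ da_n` serves. Its order at `P` can be nonzero only if the chosen prime `q`
over `P` divides the Jacobian; there are finitely many such `q` up to units, and `(q)` determines
`P`. -/
theorem exists_isCanonicalDivisor (L : Type*) [Field L] [Algebra B L] [IsFractionRing B L]
    [Algebra A L] [IsScalarTower A B L] [Algebra (FractionRing A) L]
    [IsScalarTower A (FractionRing A) L] [Algebra k L] [IsScalarTower k B L]
    [IsScalarTower k (FractionRing A) L] [Algebra.IsSeparable (FractionRing A) L]
    (G : Type*) [Group G] [Finite G] [MulSemiringAction G B]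
    [IsGaloisGroup G A B] (hΔ : IsJacobianDivisor k A b Δ) {a : Fin n → A}
    (ha : jacobian k b a ≠ 0) : ∃ K : WeilDivisor A, IsCanonicalDivisor k n K := by
  classical
  have : Algebra.IsIntegral A B := Algebra.IsInvariant.isIntegral A B G
  have hω : coordTopForms k L b (wedgeD k a) ≠ 0 := by
    rwa [coordTopForms_wedgeD, Ne, FaithfulSMul.algebraMap_eq_zero_iff]
  have hω0 : wedgeD k a ≠ 0 := fun h => hω (by rw [h, map_zero])
  have hord (P : PrimeDivisor A) : ∃ (q : B) (m : ℤ), Prime q ∧ LiesOver q P ∧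
      HasOrder P (regularForms k n P) (wedgeD k a) m ∧ (¬ q ∣ jacobian k b a → m = 0) := by
    obtain ⟨q, hq, hP⟩ := exists_prime_liesOver B P
    obtain ⟨ϖ, hϖ, hfac⟩ := exists_isUniformizer L G hq hP
    obtain ⟨η, hη, u, hu, huη⟩ := exists_regularForms_eq_span k L b G hΔ hq hP
    have hη0 : η ≠ 0 := by
      rintro rfl
      rw [map_zero] at huη
      refine mul_ne_zero ?_ hu.ne_zero huη.symm
      rw [Ne, FaithfulSMul.algebraMap_eq_zero_iff]
      exact hΔ.1
    obtain ⟨g, hg⟩ := (finrank_eq_one_iff_of_nonzero' _ hη0).1 (finrank_topForms k A L b)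
      (wedgeD k a)
    have hg0 : g ≠ 0 := by
      rintro rfl
      rw [zero_smul] at hg
      exact hω0 hg.symm
    have hunit (v : FractionRing A) (hv : IsUnitAt q (algebraMap _ L v)) :
        regularForms k n P = Submodule.span (localRing P.1) {v • η} := by
      have h1 : v ∈ localRing P.1 := mem_localRing_of_isIntegralAt G hq hP hv.isIntegralAt
      have h2 : v⁻¹ ∈ localRing P.1 := mem_localRing_of_isIntegralAt (L := L) G hq hP (by
        rw [map_inv₀]; exact hv.inv.isIntegralAt)
      have hv0 : v ≠ 0 := by
        rintro rfl
        exact hv.ne_zero (map_zero _)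
      rw [hη]
      refine le_antisymm ?_ ?_
      · rw [Submodule.span_singleton_le_iff_mem, Submodule.mem_span_singleton]
        exact ⟨⟨_, h2⟩, inv_smul_smul₀ hv0 η⟩
      · rw [Submodule.span_singleton_le_iff_mem, Submodule.mem_span_singleton]
        exact ⟨⟨_, h1⟩, rfl⟩
    by_cases hqa : q ∣ jacobian k b a
    · obtain ⟨m, v, hv, hgv⟩ := hfac g hg0
      refine ⟨q, m, hq, hP, ⟨ϖ, hϖ, v • η, hunit v hv, ?_⟩, fun h => (h hqa).elim⟩
      rw [← mul_smul, ← hgv, hg]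
    · refine ⟨q, 0, hq, hP, ⟨ϖ, hϖ, g • η, hunit g ?_, by rw [zpow_zero, one_smul, hg]⟩,
        fun _ => rfl⟩
      have hmem : wedgeD k a ∈ Submodule.span (localRing P.1) {η} := by
        rw [← hη, regularForms_eq_span_wedgeD]
        exact Submodule.subset_span ⟨a, rfl⟩
      obtain ⟨s, hs⟩ := Submodule.mem_span_singleton.1 hmem
      have hsg : (s : FractionRing A) = g := smul_left_injective _ hη0 (hs.trans hg.symm)
      have hgint : IsIntegralAt q (algebraMap _ L g) :=
        hsg ▸ isIntegralAt_of_mem_localRing hP s.2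
      -- The left side is a unit at `q` and both factors on the right are integral there, so `g` is
      -- a unit and the order is zero.
      have hj : algebraMap B L (jacobian k b a) = algebraMap _ L g * (algebraMap B L Δ * u) := by
        rw [← coordTopForms_wedgeD, ← hg, map_smul, huη, Algebra.smul_def]
      have hju := isUnitAt_algebraMap (L := L) hq hqa
      refine isUnitAt_of_mul_eq_one hq hgint (y := algebraMap B L Δ * u *
        (algebraMap B L (jacobian k b a))⁻¹)
        (((isIntegralAt_algebraMap hq _).mul hq hu.isIntegralAt).mul hq hju.inv.isIntegralAt) ?_
      rw [← mul_assoc, ← hj, mul_inv_cancel₀ hju.ne_zero]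
  choose q m hq hP hm hm0 using hord
  have hfin : (Function.support m).Finite := by
    have hF := (UniqueFactorizationMonoid.factors (jacobian k b a)).toFinset.finite_toSet
    refine Set.Finite.of_injOn (f := fun P => Ideal.span {q P})
      (t := (fun p : B => Ideal.span {p}) ''
        (UniqueFactorizationMonoid.factors (jacobian k b a)).toFinset) ?_ ?_ (hF.image _)
    · intro P hPm
      have hdvd : q P ∣ jacobian k b a := by
        by_contra h
        exact hPm (hm0 P h)
      obtain ⟨p, hp, hpq⟩ := UniqueFactorizationMonoid.exists_mem_factors_of_dvd ha
        (hq P).irreducible hdvd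
      exact ⟨p, by simpa using hp, (Ideal.span_singleton_eq_span_singleton.2 hpq).symm⟩
    · intro P _ P' _ h
      have hassoc : Associated (q P) (q P') := Ideal.span_singleton_eq_span_singleton.1 h
      refine Subtype.ext (PrimeSpectrum.ext (Ideal.ext fun x => ?_))
      rw [hP P x, hP P' x]
      exact hassoc.dvd_iff_dvd_left
  exact ⟨Finsupp.ofSupportFinite m hfin, wedgeD k a, hω0, hm⟩

theorem isCartier_nsmul_of_isCanonicalDivisor (L : Type*) [Field L] [Algebra B L] [IsFractionRing B L]
    [Algebra A L] [IsScalarTower A B L] [Algebra (FractionRing A) L]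
    [IsScalarTower A (FractionRing A) L] [Algebra k L] [IsScalarTower k B L]
    [IsScalarTower k (FractionRing A) L] [Algebra.IsSeparable (FractionRing A) L]
    (G : Type*) [Group G] [Finite G]
    [MulSemiringAction G B] [IsGaloisGroup G A B] (hΔ : IsJacobianDivisor k A b Δ) {a : Fin n → A}
    (ha : jacobian k b a ≠ 0) {r : ℕ} {γ δ : A} (hγ : algebraMap A B γ = jacobian k b a ^ r)
    (hδ : algebraMap A B δ = Δ ^ r) {K : WeilDivisor A} (hK : IsCanonicalDivisor k n K) :
    WeilDivisor.IsCartier (r • K) := by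
  have : Algebra.IsIntegral A B := Algebra.IsInvariant.isIntegral A B G
  obtain ⟨ω, hω0, hω⟩ := hK
  have hJ0 : algebraMap B L (jacobian k b a) ≠ 0 := by
    rwa [Ne, FaithfulSMul.algebraMap_eq_zero_iff]
  have hΔ0 : algebraMap B L Δ ≠ 0 := by
    rw [Ne, FaithfulSMul.algebraMap_eq_zero_iff]
    exact hΔ.1
  have hη0 : wedgeD k a ≠ 0 := fun h => hJ0 (by rw [← coordTopForms_wedgeD, h, map_zero])
  obtain ⟨f, rfl⟩ := (finrank_eq_one_iff_of_nonzero' _ hη0).1 (finrank_topForms k A L b) ω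
  have hf0 : f ≠ 0 := by
    rintro rfl
    exact hω0 (zero_smul _ _)
  -- `F` is `(f J / Δ) ^ r`, which descends because `γ` and `δ` do. It is an equation of `r • K`
  -- everywhere, so the neighbourhood below is all of `X` (`s = 1`).
  set F : FractionRing A := f ^ r * (algebraMap _ _ γ / algebraMap _ _ δ) with hF
  have hFL : algebraMap _ L F =
      (algebraMap _ L f * algebraMap B L (jacobian k b a) / algebraMap B L Δ) ^ r := by
    rw [hF, map_mul, map_div₀, algebraMap_algebraMap (B := B), algebraMap_algebraMap (B := B), hγ,
      hδ, map_pow, map_pow, map_pow, ← div_pow, ← mul_pow, mul_div_assoc]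
  have hF0 : F ≠ 0 := by
    rw [← map_ne_zero (algebraMap _ L), hFL]
    exact pow_ne_zero _ (div_ne_zero (mul_ne_zero ((map_ne_zero _).2 hf0) hJ0) hΔ0)
  refine fun x => ⟨1, fun h => x.2.ne_top ((Ideal.eq_top_iff_one _).2 h), F, hF0, fun P _ => ?_⟩
  obtain ⟨q, hq, hP⟩ := exists_prime_liesOver B P
  obtain ⟨η, hη, u, hu, huη⟩ := exists_regularForms_eq_span k L b G hΔ hq hP
  obtain ⟨ϖ, hϖ, e, he, hωe⟩ := hω P
  obtain ⟨s, hs⟩ := exists_eq_smul_of_span_singleton_eq (he.symm.trans hη)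
  obtain ⟨t, ht⟩ := exists_eq_smul_of_span_singleton_eq (hη.symm.trans he)
  have hηne : η ≠ 0 := by
    rintro rfl
    rw [map_zero] at huη
    exact mul_ne_zero hΔ0 hu.ne_zero huη.symm
  -- Two generators of the regular forms differ by a unit, so `e` has coordinate `Δ` up to a unit as
  -- well as `η`.
  have hts : (t : FractionRing A) * s = 1 := by
    refine smul_left_injective _ hηne ?_
    change ((t : FractionRing A) * s) • η = (1 : FractionRing A) • η
    rw [one_smul, mul_smul]
    conv_rhs => rw [ht, hs]
    rfl
  have hsu : IsUnitAt q (algebraMap _ L (s : FractionRing A)) :=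
    isUnitAt_of_mul_eq_one hq (isIntegralAt_of_mem_localRing hP s.2)
      (isIntegralAt_of_mem_localRing hP t.2) (by rw [← map_mul, mul_comm, hts, map_one])
  have hϖ0 : (ϖ : FractionRing A) ≠ 0 := fun h => hϖ.1 (Subtype.ext h)
  have hϖL : algebraMap _ L (ϖ : FractionRing A) ≠ 0 := (map_ne_zero _).2 hϖ0
  have hfJ : algebraMap _ L f * algebraMap B L (jacobian k b a) / algebraMap B L Δ =
      algebraMap _ L (ϖ : FractionRing A) ^ (K P) * (algebraMap _ L (s : FractionRing A) * u) := by
    have h := congrArg (coordTopForms k L b) hωe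
    have hs' : e = (s : FractionRing A) • η := hs
    rw [map_smul, coordTopForms_wedgeD, map_smul, hs', map_smul, huη, Algebra.smul_def,
      Algebra.smul_def, Algebra.smul_def, map_zpow₀] at h
    rw [h]
    field_simp
  -- `W` is a unit at `q`, so both `W` and its inverse lie in the local ring at `P`; hence `W`
  -- generates it, as `HasOrder` requires.
  set W : FractionRing A := ((ϖ : FractionRing A) ^ ((r • K) P))⁻¹ * F with hW
  have hWL : IsUnitAt q (algebraMap _ L W) := by
    have : algebraMap _ L W = (algebraMap _ L (s : FractionRing A) * u) ^ r := by
      rw [hW, map_mul, hFL, hfJ, mul_pow, map_inv₀, map_zpow₀, ← zpow_natCast, ← zpow_mul,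
        inv_mul_eq_iff_eq_mul₀ (zpow_ne_zero _ hϖL), Finsupp.smul_apply, nsmul_eq_mul, mul_comm (r : ℤ)]
    rw [this]
    exact (hsu.mul hq hu).pow hq r
  have hW0 : W ≠ 0 := by
    intro h
    exact hWL.ne_zero (by rw [h, map_zero])
  have h1 : W ∈ localRing P.1 := mem_localRing_of_isIntegralAt G hq hP hWL.isIntegralAt
  have h2 : W⁻¹ ∈ localRing P.1 := mem_localRing_of_isIntegralAt (L := L) G hq hP (by
    rw [map_inv₀]; exact hWL.inv.isIntegralAt)
  refine ⟨ϖ, hϖ, W, le_antisymm ?_ ?_, ?_⟩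
  · rw [Submodule.span_singleton_le_iff_mem, Submodule.mem_span_singleton]
    exact ⟨⟨_, h2⟩, inv_mul_cancel₀ hW0⟩
  · rw [Submodule.span_singleton_le_iff_mem, Submodule.mem_span_singleton]
    exact ⟨⟨_, h1⟩, mul_one W⟩
  · rw [hW, smul_eq_mul, mul_inv_cancel_left₀ (zpow_ne_zero _ hϖ0)]

end Gorenstein

/-! ### Passage to the Galois extension of fraction fields -/

section Descent

/-- If the Jacobian determinants of tuples of invariants generate, in codimension one, the same
ideal as `Δ`, then the quotient is `r`-Gorenstein as soon as the `r`-th powers of `Δ` and of some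
nonzero Jacobian determinant are invariant. -/
theorem isGorensteinOfIndex_of_isJacobianDivisor (k : Type*) [Field k] {A B : Type*} [CommRing A]
    [IsDomain A] [CommRing B] [IsDomain B] [UniqueFactorizationMonoid B] [Algebra A B]
    [FaithfulSMul A B] [Algebra k A] [Algebra k B] [IsScalarTower k A B] {n : ℕ}
    {b : Module.Basis (Fin n) B (Ω[B⁄k])} (G : Type*) [Group G] [Finite G] [MulSemiringAction G B]
    [IsGaloisGroup G A B] {Δ : B} (hΔ : IsJacobianDivisor k A b Δ) {a : Fin n → A}
    (ha : jacobian k b a ≠ 0) {r : ℕ} {γ δ : A} (hγ : algebraMap A B γ = jacobian k b a ^ r)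
    (hδ : algebraMap A B δ = Δ ^ r) : IsGorensteinOfIndex k A n r := by
  let := FractionRing.liftAlgebra A (FractionRing B)
  let := IsFractionRing.mulSemiringAction G B (FractionRing B)
  have : Algebra.IsIntegral A B := Algebra.IsInvariant.isIntegral A B G
  have := IsGaloisGroup.to_isFractionRing_of_isIntegral G A B (FractionRing A) (FractionRing B)
  have := IsGaloisGroup.isGalois G (FractionRing A) (FractionRing B)
  have : IsScalarTower k (FractionRing A) (FractionRing B) := IsScalarTower.to₁₃₄ k A _ _
  exact ⟨exists_isCanonicalDivisor k b (FractionRing B) G hΔ ha, fun K hK =>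
    isCartier_nsmul_of_isCanonicalDivisor k b (FractionRing B) G hΔ ha hγ hδ hK⟩

end Descent

open MvPolynomial

variable {k : Type*} [Field k] {n : ℕ} {G : Subgroup (Equiv.Perm (Fin n))}

/-! ### Invariance of powers of the reflecting form and of Jacobians -/

section ReflForm

/-- Up to sign the square is the product `D` over ordered pairs `(i, j)`, `i ≠ j`, with the swap in
`G`. Conjugation by `σ` permutes these pairs, so no signs need tracking. -/
theorem rename_reflForm_sq {σ : Equiv.Perm (Fin n)} (hσ : σ ∈ G) :
    rename σ (reflForm k G) ^ 2 = reflForm k G ^ 2 := by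
  classical
  let T : Finset (Fin n × Fin n) := {p | p.1 < p.2 ∧ Equiv.swap p.1 p.2 ∈ G}
  let S : Finset (Fin n × Fin n) := {p | p.1 ≠ p.2 ∧ Equiv.swap p.1 p.2 ∈ G}
  let D : MvPolynomial (Fin n) k := ∏ p ∈ S, (X p.1 - X p.2)
  have hΔ : reflForm k G = ∏ p ∈ T, (X p.1 - X p.2) := rfl
  have hS : S = T ∪ T.map (Equiv.prodComm _ _).toEmbedding := by
    ext ⟨i, j⟩
    simp only [S, T, Finset.mem_filter, Finset.mem_univ, true_and, Finset.mem_union,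
      Finset.mem_map_equiv, Equiv.prodComm_symm, Equiv.prodComm_apply, Prod.swap_prod_mk,
      Equiv.swap_comm j i, ne_iff_lt_or_gt, or_and_right]
  have hdisj : Disjoint T (T.map (Equiv.prodComm _ _).toEmbedding) := by
    rw [Finset.disjoint_left]
    rintro ⟨i, j⟩ h1 h2
    simp only [T, Finset.mem_filter, Finset.mem_map_equiv, Equiv.prodComm_symm,
      Equiv.prodComm_apply, Prod.swap_prod_mk] at h1 h2
    exact h1.2.1.asymm h2.2.1
  have hD : D = (-1) ^ T.card * reflForm k G ^ 2 := by
    change ∏ p ∈ S, (X p.1 - X p.2 : MvPolynomial (Fin n) k) = _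
    rw [hS, Finset.prod_union hdisj, Finset.prod_map, sq, ← mul_assoc, mul_comm, hΔ]
    congr 1
    rw [← Finset.prod_const, ← Finset.prod_mul_distrib]
    refine Finset.prod_congr rfl fun p _ => ?_
    simp
  have hσD : rename σ D = D := by
    rw [map_prod]
    refine Finset.prod_equiv (Equiv.prodCongr σ σ) (fun p => ?_) fun p _ => by simp
    simp only [S, Finset.mem_filter, Finset.mem_univ, true_and, Equiv.prodCongr_apply, Prod.map,
      Ne, σ.injective.eq_iff, Equiv.swap_apply_apply]
    refine and_congr_right fun _ => ?_
    rw [G.mul_mem_cancel_right (inv_mem hσ), G.mul_mem_cancel_left hσ]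
  rw [hD, map_mul, map_pow, map_neg, map_one, map_pow] at hσD
  exact mul_left_cancel₀ (pow_ne_zero _ (neg_ne_zero.2 one_ne_zero)) hσD

theorem reflForm_sq_mem : reflForm k G ^ 2 ∈ invariantRing k G := fun σ hσ => by
  rw [map_pow, rename_reflForm_sq hσ]

theorem jac_sq_mem {a : Fin n → MvPolynomial (Fin n) k} (ha : ∀ l, a l ∈ invariantRing k G) :
    jac a ^ 2 ∈ invariantRing k G := fun σ hσ => by
  rw [map_pow, rename_jac σ fun i => ha i σ hσ, mul_pow]
  rcases Int.units_eq_one_or (Equiv.Perm.sign σ) with h | h <;> simp [h]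

theorem reflForm_mem_of_charP_two [CharP k 2] : reflForm k G ∈ invariantRing k G := fun σ hσ => by
  rcases sq_eq_sq_iff_eq_or_eq_neg.1 (rename_reflForm_sq (k := k) hσ) with h | h
  · exact h
  · rw [h, CharTwo.neg_eq]

theorem jac_mem_of_charP_two [CharP k 2] {a : Fin n → MvPolynomial (Fin n) k}
    (ha : ∀ l, a l ∈ invariantRing k G) : jac a ∈ invariantRing k G := fun σ hσ => by
  rw [rename_jac σ fun i => ha i σ hσ]
  rcases Int.units_eq_one_or (Equiv.Perm.sign σ) with h | h <;> simp [h, CharTwo.neg_eq]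

end ReflForm

/-! ### The permutation action on the polynomial ring -/

section Instantiation

variable (k G) in
/-- The permutation action on the polynomial ring. -/
abbrev permAction : MulSemiringAction G (MvPolynomial (Fin n) k) where
  smul σ f := rename (σ : Equiv.Perm (Fin n)) f
  one_smul f := rename_id_apply f
  mul_smul _ _ f := rename_mul _ _ f
  smul_zero _ := map_zero _
  smul_add _ := map_add _
  smul_one _ := map_one _
  smul_mul _ := map_mul _

variable (k G) in
theorem isGaloisGroup_permAction :
    letI := permAction k G
    IsGaloisGroup G (invariantRing k G) (MvPolynomial (Fin n) k) :=
  letI := permAction k G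
  { faithful := ⟨fun {σ τ} h => Subtype.ext <| Equiv.ext fun i => X_injective (R := k) <| by
      have : rename (σ : Equiv.Perm (Fin n)) (X i : MvPolynomial (Fin n) k) =
        rename (τ : Equiv.Perm (Fin n)) (X i) := h (X i)
      rwa [rename_X, rename_X] at this⟩
    commutes := ⟨fun σ a f => by
      change rename (σ : Equiv.Perm (Fin n)) ((a : MvPolynomial (Fin n) k) * f) =
        (a : MvPolynomial (Fin n) k) * rename (σ : Equiv.Perm (Fin n)) f
      rw [map_mul, a.2 _ σ.2]⟩
    isInvariant := ⟨fun f hf => ⟨⟨f, fun σ hσ => hf ⟨σ, hσ⟩⟩, rfl⟩⟩ }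

theorem jacobian_mvPolynomialBasis (a : Fin n → invariantRing k G) :
    jacobian k (KaehlerDifferential.mvPolynomialBasis k (Fin n)) a =
      jac fun i => (a i : MvPolynomial (Fin n) k) := by
  rw [jacobian, jac]
  congr 1
  ext1 i j
  rw [Matrix.of_apply, Matrix.of_apply, KaehlerDifferential.mvPolynomialBasis_repr_apply,
    grad_apply]
  rfl

variable (k G) in
theorem isJacobianDivisor_reflForm :
    IsJacobianDivisor k (invariantRing k G) (KaehlerDifferential.mvPolynomialBasis k (Fin n))
      (reflForm k G) := by
  refine ⟨reflForm_ne_zero, fun q hq => ?_⟩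
  obtain ⟨d, e, hde, he, hd, a, ha, c, hc, hac⟩ := exists_reflForm_eq_mul (G := G) hq
  refine ⟨d, e, hde, he, fun a' => ?_, fun i => ⟨a i, ha i⟩, c, hc, ?_⟩
  · rw [jacobian_mvPolynomialBasis]
    exact hd _ fun l => (a' l).2
  · rw [jacobian_mvPolynomialBasis, hac]

theorem isGorensteinOfIndex_invariantRing {a : Fin n → MvPolynomial (Fin n) k}
    (ha : ∀ l, a l ∈ invariantRing k G) (ha0 : jac a ≠ 0) {r : ℕ}
    (hr : jac a ^ r ∈ invariantRing k G) (hr' : reflForm k G ^ r ∈ invariantRing k G) :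
    IsGorensteinOfIndex k (invariantRing k G) n r := by
  let := permAction k G
  have := isGaloisGroup_permAction k G
  have hj := jacobian_mvPolynomialBasis fun i => (⟨a i, ha i⟩ : invariantRing k G)
  exact isGorensteinOfIndex_of_isJacobianDivisor k G (isJacobianDivisor_reflForm k G)
    (a := fun i => ⟨a i, ha i⟩) (by rwa [hj]) (γ := ⟨_, hr⟩) (δ := ⟨_, hr'⟩) (by rw [hj]; rfl) rfl

end Instantiation

end PermQuotient

end

theorem lemma3p1 (k : Type*) [Field k] (n : ℕ) (G : Subgroup (Equiv.Perm (Fin n))) :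
    PermQuotient.IsGorensteinOfIndex k (PermQuotient.invariantRing k G) n 2 ∧
      (CharP k 2 → PermQuotient.IsGorensteinOfIndex k (PermQuotient.invariantRing k G) n 1) := by
  obtain ⟨a, ha, ha0⟩ := PermQuotient.exists_jac_ne_zero k G
  refine ⟨PermQuotient.isGorensteinOfIndex_invariantRing ha ha0 (PermQuotient.jac_sq_mem ha)
    PermQuotient.reflForm_sq_mem, fun _ => ?_⟩
  refine PermQuotient.isGorensteinOfIndex_invariantRing ha ha0 ?_ ?_
  · rw [pow_one]
    exact PermQuotient.jac_mem_of_charP_two ha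
  · rw [pow_one]
    exact PermQuotient.reflForm_mem_of_charP_two
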